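/- Let $g=2$ and let $S=\mathbf{C}[X_{00},X_{01},X_{10},X_{11}]=\bigoplus_k S_k$, with variables $X_\sigma$ indexed by $\sigma\in\mathbf{F}_2^2$, $S_k$ the polynomials that are homogeneous of degree $k$, and $\partial_\sigma=\partial/\partial X_\sigma$. Let $F_{ij}=2(E_{ij}-E_{ji})$ $(1\le i,j\le 6)$ in $so(6)$ (skew symmetric complex matrices) and $\Omega_{ij}=F_{ij}\otimes F_{ij}\in U(so(6))$. Let $\rho_s:so(6)\to \mathrm{End}(S_1)$ be the half spin representation constructed from the Heisenberg group as follows. For $x=(\xi,\xi')\in\mathbf{F}_2^3\times\mathbf{F}_2^3$ let $U^\sharp_x$ be the operator $f\mapsto\big(\sigma\mapsto t_x(-1)^{\sigma\xi'}f(\sigma+\xi)\big)$ on functions $\mathbf{F}_2^3\to\mathbf{C}$, with $t_x\in\{1,i\}$ such that $(U^\sharp_x)^2=I$. Then $F_{jk}$ $(j\ne k)$ acts by $U^\sharp_{x_{j,8}}U^\sharp_{x_{k,8}}$, restricted to the functions supported on $\sigma_1+\sigma_2+\sigma_3=0$, a space which is identified with $S_1$ by $\delta_{(\sigma_1,\sigma_2,\sigma_1+\sigma_2)}\mapsto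 X_{\sigma_1\sigma_2}$. Here $x_T=(\xi,\xi')\in\mathbf{F}_2^3\times\mathbf{F}_2^3$, for $T\subset\{1,\dots,8\}$ of even cardinality, is given by $\xi_i=|T\cap\{2i-1,2i\}|$ and $\xi'_i=|T\cap\{2i,\dots,7\}|$ mod $2$. Let $so(6)$ act on $S$ by the first order differential operators $\sum a_{\sigma\tau}X_\sigma\partial_\tau$, with $(a_{\sigma\tau})$ the matrix of $\rho_s(A)$, and let $\tilde\rho_s$ be the resulting action of $U(so(6))$ on $S$ by differential operators. For an operator $D$ of order at most two, let $\sigma(D)$ be its symbol viewed as an operator on $S$ in the normalization $\sigma(\partial_a\partial_b)=2\,\partial_a\partial_b$ (twice the second order part of $D$). Put $$R_{123}=2\,\sigma\big(\tilde\rho_s(\Omega_{12}+\Omega_{13}+\Omega_{23})\big),\qquad Q=X_{00}X_{10}-X_{01}X_{11},\qquad X_Q=\partial_{00}\partial_{10}-\partial_{01}\partial_{11},$$ $R_Q=QX_Q$, and $V_n=\ker(X_Q)\cap S_n$. 1. There are constants $\lambda_k\in\mathbf{Q}$ such that $R_{123}=16\,QX_Q+\lambda_k I$ on $S_k$, for all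 $k\ge 0$. 2. For every $k\ge0$ one has $S_k=\bigoplus_{0\le l\le k/2}Q^lV_{k-2l}$. For $0\le l\le k/2$ the subspace $Q^lV_{k-2l}$ is the eigenspace of $R_Q$ on $S_k$ with eigenvalue $l(k-l+1)$, and $\dim V_{k-2l}=(k-2l+1)^2$. 3. Let $k\ge 0$. On the configuration space $\mathcal{P}=\{z\in\mathbf{C}^6: z_i\ne z_j \text{ for } i\neq j\}$ consider the connection $\nabla(fw)=w\,df-f\omega_k(w)$ on the trivial bundle $S_k\otimes\mathcal{O}_{\mathcal P}$ (the explicit form of Hitchin's connection of level $k$), with $$\omega_k=\frac{-1}{16(k+2)}\sum_{i\neq j}\sigma(\tilde\rho_s(\Omega_{ij}))\,\frac{dz_i}{z_i-z_j}\qquad\text{(sum over ordered pairs)}.$$ Let $z_1,\dots,z_6$ be distinct and nonzero, and let $\varepsilon>0$ be so small that $\phi(t)=(t^2z_1,t^2z_2,t^2z_3,z_4,z_5,z_6)$ lies in $\mathcal P$ for $0<|t|<\varepsilon$. Let $\gamma$ be the image under $\phi$ of a circle $|t|=r<\varepsilon$ traversed once anticlockwise (a Dehn twist in a separating simple loop,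 for the curves $y^2=\prod_i(x-z_i)$). Then the monodromy of $\gamma$ on $S_k$ has the eigenvalues $$c\cdot\exp\Big(-2\pi i\,\frac{l(l+1)}{k+2}\Big)\quad\text{with multiplicity }(k-2l+1)^2,\qquad l\in\mathbf{Z},\ 0\le l\le k/2,$$ where $c\ne0$ is a constant that depends only on $k$. Multiplicities are algebraic, and are added when the values for different $l$ coincide: the characteristic polynomial of the monodromy is $\prod_{0\le l\le k/2}\big(T-c\,e^{-2\pi i\,l(l+1)/(k+2)}\big)^{(k-2l+1)^2}$. The monodromy of a loop is taken to be the inverse of parallel transport along it (so that a simple pole with residue $R$ of the connection form gives the eigenvalues of $\exp(-2\pi iR)$). -/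

import Mathlib

namespace HitchinGenusTwo

noncomputable section

attribute [local instance 100] LieRing.ofAssociativeRing

/-! ### The Heisenberg group in its Schroedinger representation -/

/-- The sign `(-1)^a` for `a` in `ZMod 2`. -/
def sgn (a : ZMod 2) : ℂ := (-1) ^ a.val

/-- The operator `U(t, (ξ, ξ'))` of the Schroedinger representation on the space of functions
`F_2^n → ℂ`: it sends `f` to `σ ↦ t (-1)^(σ ξ') f(σ + ξ)`. -/
def schroedinger (n : ℕ) (t : ℂ) (x : (Fin n → ZMod 2) × (Fin n → ZMod 2)) :
    Module.End ℂ ((Fin n → ZMod 2) → ℂ) where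
  toFun f := fun σ => t * sgn (σ ⬝ᵥ x.2) * f (σ + x.1)
  map_add' f g := by funext σ; simp [mul_add]
  map_smul' c f := by funext σ; simp; ring

/-- The operator `U_x = U(t_x, x)`, with `t_x ∈ {1, i}` chosen such that `U_x ^ 2 = 1`. -/
def involution (n : ℕ) (x : (Fin n → ZMod 2) × (Fin n → ZMod 2)) :
    Module.End ℂ ((Fin n → ZMod 2) → ℂ) :=
  schroedinger n (if x.1 ⬝ᵥ x.2 = 0 then 1 else Complex.I) x

/-- The point `x_T` of `F_2^g × F_2^g` given by an even subset `T` of `{1, …, 2g+2}`, under the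
isomorphism with `x_{2i-1,2i} = (0, e_i)`, `x_{2i,…,2g+1} = (e_i, 0)` for `1 ≤ i ≤ g`.
The coordinates are the symplectic products `|T ∩ S| mod 2` with these basis elements `x_S`.
(The index `i : Fin g` stands for `i + 1`.) -/
def point (g : ℕ) (T : Finset ℕ) : (Fin g → ZMod 2) × (Fin g → ZMod 2) :=
  (fun i => ((T ∩ {2 * (i : ℕ) + 1, 2 * (i : ℕ) + 2}).card : ZMod 2),
   fun i => ((T ∩ Finset.Icc (2 * (i : ℕ) + 2) (2 * g + 1)).card : ZMod 2))

/-! ### The half spin representation of `so(6)` -/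

/-- The orthogonal Lie algebra `so(6)` of skew symmetric complex matrices. -/
abbrev SO6 := LieAlgebra.Orthogonal.so (Fin 6) ℂ

/-- The generator `e_{k+1}` of the Clifford algebra of `x_1^2 + … + x_6^2`, acting on functions on
`F_2^3` as `U_x` with `x = x_{k+1, 8}`. -/
def cliff (k : Fin 6) : Module.End ℂ ((Fin 3 → ZMod 2) → ℂ) :=
  involution 3 (point 3 {(k : ℕ) + 1, 8})

/-- The element `F_ij = 2 (E_ij - E_ji)` of `so(6)`. -/
def F (i j : Fin 6) : SO6 :=
  ⟨(2 : ℂ) • (Matrix.single i j 1 - Matrix.single j i 1), by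
    rw [LieAlgebra.Orthogonal.mem_so]
    simp [Matrix.transpose_sub, ← smul_neg]⟩

/-- The spin representation `A ↦ (1/4) ∑ A_jk e_j e_k` as a linear map; it sends `F_jk` to
`e_j e_k` for `j ≠ k` (see `spinSharp_F`). -/
def spinSharp : SO6 →ₗ[ℂ] Module.End ℂ ((Fin 3 → ZMod 2) → ℂ) where
  toFun A := (1 / 4 : ℂ) • ∑ j, ∑ k, (A : Matrix (Fin 6) (Fin 6) ℂ) j k • (cliff j * cliff k)
  map_add' A B := by simp [add_smul, Finset.sum_add_distrib]
  map_smul' c A := by simp [Finset.smul_sum, smul_smul]; simp only [mul_left_comm]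

/-- The space `V` of functions `F_2^2 → ℂ`, identified with the space `V^♯_+` of functions on
`F_2^3` supported on `σ_1 + σ_2 + σ_3 = 0` by `X_{σ_1 σ_2} ↔ Y_{σ_1 σ_2 (σ_1 + σ_2)}`: the
inclusion of `V` in the space `V^♯` of all functions on `F_2^3`. -/
def incl : ((Fin 2 → ZMod 2) → ℂ) →ₗ[ℂ] ((Fin 3 → ZMod 2) → ℂ) where
  toFun f := fun σ => if σ 0 + σ 1 + σ 2 = 0 then f ![σ 0, σ 1] else 0
  map_add' f g := by funext σ; simp only [Pi.add_apply]; split_ifs <;> simp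
  map_smul' c f := by funext σ; simp

/-- The projection of `V^♯` on `V^♯_+ ≃ V`, a left inverse of `incl`. -/
def proj : ((Fin 3 → ZMod 2) → ℂ) →ₗ[ℂ] ((Fin 2 → ZMod 2) → ℂ) where
  toFun f := fun σ => f ![σ 0, σ 1, σ 0 + σ 1]
  map_add' _ _ := rfl
  map_smul' _ _ := rfl

theorem sgn_add (a b : ZMod 2) : sgn (a + b) = sgn a * sgn b := by
  have h : ∀ a b : ZMod 2, (a + b).val % 2 = (a.val + b.val) % 2 := by decide
  rw [sgn, sgn, sgn, ← pow_add, neg_one_pow_eq_pow_mod_two, h, ← neg_one_pow_eq_pow_mod_two]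

theorem schroedinger_mul (n : ℕ) (s t : ℂ) (x y : (Fin n → ZMod 2) × (Fin n → ZMod 2)) :
    schroedinger n s x * schroedinger n t y
      = schroedinger n (s * t * sgn (x.1 ⬝ᵥ y.2)) (x + y) := by
  refine LinearMap.ext fun f => funext fun σ => ?_
  simp [schroedinger, add_dotProduct, dotProduct_add, sgn_add, add_assoc]
  ring

theorem cliff_anticomm (j k : Fin 6) :
    cliff j * cliff k + cliff k * cliff j = if j = k then 2 else 0 := by
  have h0 : schroedinger 3 1 0 = 1 :=
    LinearMap.ext fun f => funext fun σ => by simp [schroedinger, sgn]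
  have hne : ∀ j k : Fin 6, j ≠ k →
      (point 3 {(j : ℕ) + 1, 8}).1 ⬝ᵥ (point 3 {(k : ℕ) + 1, 8}).2
        = (point 3 {(k : ℕ) + 1, 8}).1 ⬝ᵥ (point 3 {(j : ℕ) + 1, 8}).2 + 1 := by decide
  have hadd : ∀ x : (Fin 3 → ZMod 2) × (Fin 3 → ZMod 2), x + x = 0 := by decide
  split_ifs with h
  · subst h
    have : cliff j * cliff j = 1 := by
      rw [cliff, involution, schroedinger_mul, hadd, ← h0]
      congr 1
      split_ifs with h1
      · simp [h1, sgn]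
      · have h2 : ∀ a : ZMod 2, a ≠ 0 → a = 1 := by decide
        simp [h2 _ h1, sgn, ZMod.val_one]
    rw [this]; norm_num
  · have hneg : ∀ (c : ℂ) (x : (Fin 3 → ZMod 2) × (Fin 3 → ZMod 2)),
        schroedinger 3 (-c) x = -schroedinger 3 c x := fun c x =>
      LinearMap.ext fun f => funext fun σ => by simp [schroedinger]
    have hs : ∀ a : ZMod 2, sgn (a + 1) = -sgn a := fun a => by
      rw [sgn_add]; simp [sgn, ZMod.val_one]
    rw [cliff, involution, cliff, involution, schroedinger_mul, schroedinger_mul, hne j k h,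
      add_comm (point 3 {(k : ℕ) + 1, 8}), hs, mul_neg, hneg]
    generalize (if (point 3 {(j : ℕ) + 1, 8}).1 ⬝ᵥ (point 3 {(j : ℕ) + 1, 8}).2 = 0
      then (1 : ℂ) else Complex.I) = u
    rw [mul_comm u, neg_add_cancel]

theorem proj_incl (f : (Fin 2 → ZMod 2) → ℂ) : proj (incl f) = f := by
  have h : ∀ σ : Fin 2 → ZMod 2, σ 0 + σ 1 + (σ 0 + σ 1) = 0 ∧ ![σ 0, σ 1] = σ := by decide
  funext σ
  simp [proj, incl, h]

theorem incl_proj_spinSharp (A : SO6) (f : (Fin 2 → ZMod 2) → ℂ) :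
    incl (proj (spinSharp A (incl f))) = spinSharp A (incl f) := by
  have hs : ∀ (j : Fin 6) (σ : Fin 3 → ZMod 2),
      (σ + (point 3 {(j : ℕ) + 1, 8}).1) 0 + (σ + (point 3 {(j : ℕ) + 1, 8}).1) 1
        + (σ + (point 3 {(j : ℕ) + 1, 8}).1) 2 = σ 0 + σ 1 + σ 2 + 1 := by decide
  have hc : ∀ σ : Fin 3 → ZMod 2, σ 0 + σ 1 + σ 2 = 0 → ![σ 0, σ 1, σ 0 + σ 1] = σ := by decide
  have h11 : ∀ a : ZMod 2, a + 1 + 1 = a := by decide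
  funext σ
  by_cases h : σ 0 + σ 1 + σ 2 = 0
  · simp [incl, proj, h, hc]
  · have h1 : ∀ j k, cliff j (cliff k (incl f)) σ = 0 := by
      intro j k
      have : incl f (σ + (point 3 {(j : ℕ) + 1, 8}).1 + (point 3 {(k : ℕ) + 1, 8}).1) = 0 := by
        have h2 := hs k (σ + (point 3 {(j : ℕ) + 1, 8}).1)
        rw [hs j, h11] at h2
        simp only [incl, LinearMap.coe_mk, AddHom.coe_mk]
        rw [if_neg]
        rwa [h2]
      simp only [cliff, involution, schroedinger, LinearMap.coe_mk, AddHom.coe_mk, this, mul_zero]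
    have h3 : spinSharp A (incl f) σ = 0 := by
      simp [spinSharp, h1]
    rw [h3]
    simp [incl, h]

theorem spinSharp_F (j k : Fin 6) (h : j ≠ k) : spinSharp (F j k) = cliff j * cliff k := by
  have h1 : cliff k * cliff j = - (cliff j * cliff k) := by
    have := cliff_anticomm j k
    rw [if_neg h] at this
    exact eq_neg_of_add_eq_zero_right this
  have h2 : ∀ a b : Fin 6, ∑ x, ∑ y, (Matrix.single a b (1 : ℂ)) x y • (cliff x * cliff y)
      = cliff a * cliff b := by
    intro a b
    rw [Finset.sum_eq_single a, Finset.sum_eq_single b]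
    · simp
    · intro y _ hy; simp [Matrix.single, hy.symm]
    · simp
    · intro x _ hx; simp [Matrix.single, hx.symm]
    · simp
  simp only [spinSharp, F, LinearMap.coe_mk, AddHom.coe_mk, Matrix.smul_apply, Matrix.sub_apply,
    smul_eq_mul, mul_smul, sub_smul, ← Finset.smul_sum, Finset.sum_sub_distrib, h2, h1]
  module

theorem sum_comm_aux {E : Type*} [Ring E] [Algebra ℂ E] (a b : Fin 6 → Fin 6 → ℂ)
    (ha : ∀ j k, a k j = -a j k) (c : Fin 6 → E) :
    ∑ j, ∑ k, (∑ i, a j i * b i k - ∑ i, b j i * a i k) • (c j * c k)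
      = ∑ m, ∑ n, b m n • ((∑ j, a j m • c j) * c n + c m * ∑ j, a j n • c j) := by
  simp only [sub_smul, Finset.sum_sub_distrib, smul_add,
    Finset.sum_add_distrib, Finset.sum_smul, Finset.smul_sum, Finset.sum_mul, Finset.mul_sum,
    smul_mul_assoc, mul_smul_comm, smul_smul]
  have e1 : ∑ x, ∑ x_1, ∑ i, (a x i * b i x_1) • (c x * c x_1)
      = ∑ x, ∑ x_1, ∑ i, (b x x_1 * a i x) • (c i * c x_1) := by
    rw [Finset.sum_comm]
    conv_rhs => rw [Finset.sum_comm]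
    refine Finset.sum_congr rfl fun x _ => ?_
    rw [Finset.sum_comm]
    simp only [mul_comm]
  have e2 : ∑ x, ∑ x_1, ∑ i, (b x i * a i x_1) • (c x * c x_1)
      = -∑ x, ∑ x_1, ∑ i, (b x x_1 * a i x_1) • (c x * c i) := by
    simp only [← Finset.sum_neg_distrib]
    refine Finset.sum_congr rfl fun x _ => ?_
    rw [Finset.sum_comm]
    refine Finset.sum_congr rfl fun i _ => Finset.sum_congr rfl fun j _ => ?_
    rw [ha j i]; module
  rw [e1, e2, sub_neg_eq_add]

theorem spinSharp_lie (A B : SO6) : spinSharp ⁅A, B⁆ = ⁅spinSharp A, spinSharp B⁆ := by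
  have hskew : ∀ (A : SO6) (j k : Fin 6), (A : Matrix (Fin 6) (Fin 6) ℂ) k j = - A.1 j k := by
    intro A j k
    have := (LieAlgebra.Orthogonal.mem_so (Fin 6) ℂ A.1).1 A.2
    simpa using congrFun (congrFun this j) k
  have hanti : ∀ j k, cliff j * cliff k = (if j = k then 2 else 0) - cliff k * cliff j :=
    fun j k => eq_sub_of_add_eq (cliff_anticomm j k)
  have hcomm : ∀ (A : SO6) (m : Fin 6),
      spinSharp A * cliff m = cliff m * spinSharp A + ∑ j, A.1 j m • cliff j := by
    intro A m
    have h1 : ∀ j k, cliff j * cliff k * cliff m = cliff m * (cliff j * cliff k)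
        + ((if k = m then (2 : ℂ) else 0) • cliff j - (if j = m then (2 : ℂ) else 0) • cliff k) := by
      intro j k
      rw [mul_assoc, hanti k m, mul_sub, ← mul_assoc, hanti j m, sub_mul, mul_assoc]
      split_ifs <;> simp [two_smul, mul_two, two_mul] <;> abel
    have h2 : ∑ j, ∑ k, A.1 j k • ((if k = m then (2 : ℂ) else 0) • cliff j
        - (if j = m then (2 : ℂ) else 0) • cliff k) = (4 : ℂ) • ∑ j, A.1 j m • cliff j := by
      simp only [smul_sub, Finset.sum_sub_distrib]
      have e1 : ∑ j, ∑ k, A.1 j k • (if k = m then (2 : ℂ) else 0) • cliff j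
          = (2 : ℂ) • ∑ j, A.1 j m • cliff j := by
        simp only [ite_smul, zero_smul, smul_ite, smul_zero, Finset.sum_ite_eq',
          Finset.mem_univ, if_true, Finset.smul_sum]
        exact Finset.sum_congr rfl fun j _ => smul_comm _ _ _
      have e2 : ∑ j, ∑ k, A.1 j k • (if j = m then (2 : ℂ) else 0) • cliff k
          = -((2 : ℂ) • ∑ j, A.1 j m • cliff j) := by
        rw [Finset.sum_comm]
        simp only [ite_smul, zero_smul, smul_ite, smul_zero, Finset.sum_ite_eq',
          Finset.mem_univ, if_true, Finset.smul_sum, ← Finset.sum_neg_distrib]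
        refine Finset.sum_congr rfl fun j _ => ?_
        rw [hskew A j m]; module
      rw [e1, e2]; module
    calc spinSharp A * cliff m
        = (1 / 4 : ℂ) • ∑ j, ∑ k, A.1 j k • (cliff j * cliff k * cliff m) := by
          simp [spinSharp, Finset.sum_mul]
      _ = cliff m * spinSharp A + (1 / 4 : ℂ) • ∑ j, ∑ k, A.1 j k •
            ((if k = m then (2 : ℂ) else 0) • cliff j
              - (if j = m then (2 : ℂ) else 0) • cliff k) := by
          simp only [h1, smul_add, Finset.sum_add_distrib, spinSharp, LinearMap.coe_mk,
            AddHom.coe_mk, mul_smul_comm, Finset.mul_sum]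
      _ = _ := by rw [h2, smul_smul]; norm_num
  have hAB : spinSharp A * spinSharp B = spinSharp B * spinSharp A
      + (1 / 4 : ℂ) • ∑ m, ∑ n, B.1 m n • ((∑ j, A.1 j m • cliff j) * cliff n
        + cliff m * ∑ j, A.1 j n • cliff j) := by
    have h1 : ∀ m n, spinSharp A * (cliff m * cliff n) = cliff m * cliff n * spinSharp A
        + ((∑ j, A.1 j m • cliff j) * cliff n + cliff m * ∑ j, A.1 j n • cliff j) := by
      intro m n
      rw [← mul_assoc, hcomm, add_mul, mul_assoc, hcomm, mul_add, mul_assoc]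
      abel
    have h2 : spinSharp B = (1 / 4 : ℂ) • ∑ m, ∑ n, B.1 m n • (cliff m * cliff n) := rfl
    rw [h2]
    rw [mul_smul_comm, smul_mul_assoc, ← smul_add, Finset.mul_sum, Finset.sum_mul,
      ← Finset.sum_add_distrib]
    congr 1
    refine Finset.sum_congr rfl fun m _ => ?_
    rw [Finset.mul_sum, Finset.sum_mul, ← Finset.sum_add_distrib]
    refine Finset.sum_congr rfl fun n _ => ?_
    rw [mul_smul_comm, smul_mul_assoc, ← smul_add, h1]
  rw [Ring.lie_def, hAB, add_sub_cancel_left]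
  have h3 : ((⁅A, B⁆ : SO6) : Matrix (Fin 6) (Fin 6) ℂ) = A.1 * B.1 - B.1 * A.1 := by
    rw [LieSubalgebra.coe_bracket, Ring.lie_def]
  change (1 / 4 : ℂ) • ∑ j, ∑ k, ((⁅A, B⁆ : SO6) : Matrix (Fin 6) (Fin 6) ℂ) j k •
    (cliff j * cliff k) = _
  rw [h3]
  congr 1
  have h4 : ∀ j k, (A.1 * B.1 - B.1 * A.1) j k
      = ∑ i, A.1 j i * B.1 i k - ∑ i, B.1 j i * A.1 i k := fun j k => rfl
  simp only [h4]
  exact sum_comm_aux (fun j k => A.1 j k) (fun j k => B.1 j k) (hskew A) cliff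

/-- The half spin representation `ρ_s` of `so(6)` on `V`: the restriction of the spin
representation to `V^♯_+ ≃ V`. -/
def halfSpin : SO6 →ₗ⁅ℂ⁆ Module.End ℂ ((Fin 2 → ZMod 2) → ℂ) where
  toFun A := proj ∘ₗ spinSharp A ∘ₗ incl
  map_add' A B := LinearMap.ext fun f => by simp
  map_smul' c A := LinearMap.ext fun f => by simp
  map_lie' {A B} := LinearMap.ext fun f => by
    simp [spinSharp_lie, Ring.lie_def, incl_proj_spinSharp]

/-! ### Differential operators on the polynomial ring -/

/-- The polynomial ring `S = ℂ[X_00, X_01, X_10, X_11]`, with variables indexed by `F_2^2`. -/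
abbrev S := MvPolynomial (Fin 2 → ZMod 2) ℂ

/-- The differential operator `∑ a_ij X_i ∂_j`. -/
def diffOp (a : Matrix (Fin 2 → ZMod 2) (Fin 2 → ZMod 2) ℂ) : Derivation ℂ S S :=
  ∑ i, ∑ j, (MvPolynomial.C (a i j) * MvPolynomial.X i : S) • MvPolynomial.pderiv j

theorem diffOp_X (a : Matrix (Fin 2 → ZMod 2) (Fin 2 → ZMod 2) ℂ) (l : Fin 2 → ZMod 2) :
    diffOp a (MvPolynomial.X l) = ∑ i, MvPolynomial.C (a i l) * MvPolynomial.X i := by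
  have hsum : ∀ (g : (Fin 2 → ZMod 2) → Derivation ℂ S S) (p : S),
      (∑ i, g i) p = ∑ i, g i p := fun g p => by
    rw [← Derivation.coeFnAddMonoidHom_apply, map_sum, Finset.sum_apply]
    rfl
  simp only [diffOp, hsum, Derivation.coe_smul, Pi.smul_apply, smul_eq_mul]
  refine Finset.sum_congr rfl fun i _ => ?_
  rw [Finset.sum_eq_single l]
  · simp
  · intro j _ hj; rw [MvPolynomial.pderiv_X_of_ne hj.symm, mul_zero]
  · simp

theorem diffOp_add (a b : Matrix (Fin 2 → ZMod 2) (Fin 2 → ZMod 2) ℂ) :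
    diffOp (a + b) = diffOp a + diffOp b :=
  MvPolynomial.derivation_ext fun l => by
    rw [Derivation.add_apply, diffOp_X, diffOp_X, diffOp_X, ← Finset.sum_add_distrib]
    exact Finset.sum_congr rfl fun i _ => by rw [Matrix.add_apply, map_add, add_mul]

theorem diffOp_smul (c : ℂ) (a : Matrix (Fin 2 → ZMod 2) (Fin 2 → ZMod 2) ℂ) :
    diffOp (c • a) = c • diffOp a :=
  MvPolynomial.derivation_ext fun l => by
    rw [Derivation.smul_apply, diffOp_X, diffOp_X, Finset.smul_sum]
    exact Finset.sum_congr rfl fun i _ => by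
      rw [Matrix.smul_apply, smul_eq_mul, map_mul, mul_assoc, MvPolynomial.smul_eq_C_mul]

theorem diffOp_lie (a b : Matrix (Fin 2 → ZMod 2) (Fin 2 → ZMod 2) ℂ) :
    diffOp (a * b - b * a) = ⁅diffOp a, diffOp b⁆ := by
  have h1 : ∀ (a b : Matrix (Fin 2 → ZMod 2) (Fin 2 → ZMod 2) ℂ) (l : Fin 2 → ZMod 2),
      diffOp a (diffOp b (MvPolynomial.X l))
        = ∑ i, MvPolynomial.C ((a * b) i l) * MvPolynomial.X i := by
    intro a b l
    have h2 : ∀ m, diffOp a (MvPolynomial.C (b m l) * MvPolynomial.X m)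
        = ∑ i, MvPolynomial.C (a i m * b m l) * MvPolynomial.X i := by
      intro m
      rw [← MvPolynomial.smul_eq_C_mul, Derivation.map_smul, diffOp_X, Finset.smul_sum]
      refine Finset.sum_congr rfl fun i _ => ?_
      rw [MvPolynomial.smul_eq_C_mul, map_mul]
      ring
    rw [diffOp_X, map_sum, Finset.sum_congr rfl fun m _ => h2 m, Finset.sum_comm]
    refine Finset.sum_congr rfl fun i _ => ?_
    rw [Matrix.mul_apply, map_sum, Finset.sum_mul]
  refine MvPolynomial.derivation_ext fun l => ?_
  rw [Derivation.commutator_apply, diffOp_X, h1, h1, ← Finset.sum_sub_distrib]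
  exact Finset.sum_congr rfl fun i _ => by rw [Matrix.sub_apply, map_sub, sub_mul]

/-- The action of `so(6)` on `S` by derivations induced by the half spin representation, where
`V = S_1` with basis the `X_σ`: `A ↦ L_A = ∑ a_ij X_i ∂_j`, with `(a_ij)` the matrix of
`ρ_s(A)`. -/
def polyRep : SO6 →ₗ⁅ℂ⁆ Module.End ℂ S where
  toFun A := (diffOp (LinearMap.toMatrix' (halfSpin A)) : S →ₗ[ℂ] S)
  map_add' A B := by
    rw [map_add, map_add, diffOp_add, Derivation.coe_add_linearMap]
  map_smul' c A := by
    rw [map_smul, map_smul, diffOp_smul, Derivation.coe_smul_linearMap, RingHom.id_apply]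
  map_lie' {A B} := by
    change (diffOp (LinearMap.toMatrix' (halfSpin ⁅A, B⁆)) : S →ₗ[ℂ] S) = _
    rw [LieHom.map_lie, Ring.lie_def, map_sub, LinearMap.toMatrix'_mul, LinearMap.toMatrix'_mul,
      diffOp_lie, Derivation.commutator_coe_linear_map]

/-- The induced representation of the universal enveloping algebra `U(so(6))` by differential
operators on `S`. -/
def envRep : UniversalEnvelopingAlgebra ℂ SO6 →ₐ[ℂ] Module.End ℂ S :=
  UniversalEnvelopingAlgebra.lift ℂ polyRep

/-- The element `Ω_ij = F_ij ⊗ F_ij` of `U(so(6))`. -/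
def Omega (i j : Fin 6) : UniversalEnvelopingAlgebra ℂ SO6 :=
  UniversalEnvelopingAlgebra.ι ℂ (F i j) * UniversalEnvelopingAlgebra.ι ℂ (F i j)

/-- The symbol of a differential operator `D` of order at most two, again viewed as a differential
operator, in the normalization `σ(∂^2/∂t^2) = 2 ∂^2/∂t^2`: the operator
`∑_{i,j} [[D, X_i], X_j](1) ∂_i ∂_j`. It is twice the second order part of `D`. -/
def symbol (D : Module.End ℂ S) : Module.End ℂ S :=
  ∑ i : Fin 2 → ZMod 2, ∑ j : Fin 2 → ZMod 2,
    LinearMap.mulLeft ℂ (D (MvPolynomial.X i * MvPolynomial.X j)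
      - MvPolynomial.X i * D (MvPolynomial.X j) - MvPolynomial.X j * D (MvPolynomial.X i)
      + MvPolynomial.X i * MvPolynomial.X j * D 1) ∘ₗ
    (MvPolynomial.pderiv i : Derivation ℂ S S).toLinearMap ∘ₗ
    (MvPolynomial.pderiv j : Derivation ℂ S S).toLinearMap

/-- The operator `R_123 = 2 σ(ρ_s(Ω_12 + Ω_13 + Ω_23))`. -/
def R123 : Module.End ℂ S :=
  (2 : ℂ) • symbol (envRep (Omega 0 1 + Omega 0 2 + Omega 1 2))

/-- The quadric `Q = X_00 X_10 - X_01 X_11`. -/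
def Q : S :=
  MvPolynomial.X ![0, 0] * MvPolynomial.X ![1, 0] - MvPolynomial.X ![0, 1] * MvPolynomial.X ![1, 1]

/-- The operator `X_Q = ∂_00 ∂_10 - ∂_01 ∂_11`. -/
def XQ : Module.End ℂ S :=
  (MvPolynomial.pderiv ![0, 0] : Derivation ℂ S S).toLinearMap ∘ₗ
      (MvPolynomial.pderiv ![1, 0] : Derivation ℂ S S).toLinearMap
    - (MvPolynomial.pderiv ![0, 1] : Derivation ℂ S S).toLinearMap ∘ₗ
      (MvPolynomial.pderiv ![1, 1] : Derivation ℂ S S).toLinearMap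

/-- The operator `R_Q = Q X_Q`. -/
def RQ : Module.End ℂ S := LinearMap.mulLeft ℂ Q ∘ₗ XQ

/-- The space `S_k` of homogeneous polynomials of degree `k`. -/
abbrev Sk (k : ℕ) : Submodule ℂ S := MvPolynomial.homogeneousSubmodule (Fin 2 → ZMod 2) ℂ k

instance (k : ℕ) : Module.Finite ℂ (Sk k) :=
  Module.Finite.iff_fg.mpr (MvPolynomial.homogeneousSubmodule_fg _ _ k)

/-- The space `V_n`, the kernel of `X_Q` on `S_n`. -/
def Vn (n : ℕ) : Submodule ℂ S := Sk n ⊓ LinearMap.ker XQ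

/-- The space `Q^l V_{k-2l}`, for `2 l ≤ k`. -/
def QV (k l : ℕ) : Submodule ℂ S := (Vn (k - 2 * l)).map (LinearMap.mulLeft ℂ (Q ^ l))

/-! ### The connection and its monodromy -/

/-- The value at the point `z` of the configuration space and the tangent vector `v` of the one
form `-1/(16(k+2)) ∑_{i ≠ j} σ(ρ_s(Ω_ij)) dz_i / (z_i - z_j)` (sum over ordered pairs). -/
def connForm (k : ℕ) (z v : Fin 6 → ℂ) : Module.End ℂ S :=
  (-1 / (16 * ((k : ℂ) + 2))) •
    ∑ i : Fin 6, ∑ j ∈ Finset.univ.erase i,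
      (v i / (z i - z j)) • symbol (envRep (Omega i j))

/-- `s` is a flat section of the trivial bundle with fibre `S_k` along the path `z` on `[0, 1]`,
for the connection `∇(f w) = w df - f ω(w)` with `ω = connForm k`:
it satisfies `s' = ω(z')(s)` (derivatives of polynomials are taken coefficientwise). -/
def IsFlatSection (k : ℕ) (z : ℝ → Fin 6 → ℂ) (s : ℝ → S) : Prop :=
  ∀ τ ∈ Set.Icc (0 : ℝ) 1, s τ ∈ Sk k ∧ ∀ m : (Fin 2 → ZMod 2) →₀ ℕ,
    HasDerivWithinAt (fun τ' => MvPolynomial.coeff m (s τ'))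
      (MvPolynomial.coeff m
        (connForm k (z τ) (fun i => derivWithin (fun τ' => z τ' i) (Set.Icc 0 1) τ) (s τ)))
      (Set.Icc 0 1) τ

/-- `M` is the monodromy of the loop `z` on the fibre `S_k` over its base point: the inverse of
parallel transport along `z`. With this convention the monodromy of a product of loops (first
factor traversed first) is the product of the monodromies, and the monodromy of a small
anticlockwise loop around a simple pole with residue `R` of the connection form has the eigenvalues
of `exp(-2πiR)`. -/
def IsMonodromy (k : ℕ) (z : ℝ → Fin 6 → ℂ) (M : Module.End ℂ (Sk k)) : Prop :=
  ∀ v w : Sk k, M v = w ↔ ∃ s : ℝ → S, IsFlatSection k z s ∧ s 1 = v ∧ s 0 = w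

/-- The map `t ↦ (t²z_1, t²z_2, t²z_3, z_4, z_5, z_6)`. -/
def degeneration (z : Fin 6 → ℂ) (t : ℂ) : Fin 6 → ℂ :=
  fun i => if (i : ℕ) < 3 then t ^ 2 * z i else z i

/-- The image under `degeneration z` of the circle of radius `r` around `0`, traversed once
anticlockwise. In the family of curves `y² = ∏ (x - z_i)` this is a Dehn twist in a separating
simple loop. -/
def dehnLoop (z : Fin 6 → ℂ) (r : ℝ) (τ : ℝ) : Fin 6 → ℂ :=
  degeneration z ((r : ℂ) * Complex.exp (2 * Real.pi * Complex.I * (τ : ℂ)))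

end

end HitchinGenusTwo

/-!
`S_1` is the sum of two doublets `(X_00, X_11)` and `(X_01, X_10)` for the copy of `so(3)` spanned
by `F_12, F_13, F_23`, and `Q` is their determinant. The symbol of `Ω_ij` is
`2 ∑ L(X_a) L(X_b) ∂_a ∂_b` with `L` the derivation given by `F_ij` (`symbol_Omega`). Summing the
three symbols leaves `16 Q X_Q` and a multiple of `∑ X_a X_b ∂_a ∂_b`, which is the scalar
`k (k - 1)` on `S_k` by Euler's identity (`R123_apply`).

The decomposition of `S_k` is the classical one into harmonic polynomials for the quadric `Q`. The
relation `[X_Q, Q] = E + 2`, with `E` the Euler operator (`XQ_Q_mul`), shows that `Q X_Q` has the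
eigenvalue `l (k - l + 1)` on `Q^l V_{k-2l}` and that `X_Q Q` is invertible on the sum of these
spaces. By induction on the degree they span `S_k` (`iSup_QV`), and they are independent because the
eigenvalues are distinct. So `X_Q : S_{k+2} → S_k` is onto, which gives `dim V_n`.

For the monodromy, the connection form pulls back along the degeneration to `A(t) dt / t`, where `A`
is holomorphic near `0` and `A(0) = -R_123 / (16 (k + 2))` (`connForm_dehnLoop`, `degForm_zero`).
Differences of eigenvalues of `A(0)` may be integers, so that a gauge transformation to constant
coefficients need not exist. Instead, the flat sections on the circle of radius `t` satisfy
`y' = 2πi A(t exp(2πiτ)) y`, an equation which makes sense for every complex `t` in the disc,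
including `t = 0`. Its fundamental solution is holomorphic in `t` (`exists_fundamental_solution`, by
the Dyson series). Rotating `t` only moves the base point on the circle, and so conjugates the
monodromy. The characteristic polynomial of the monodromy is therefore holomorphic and rotation
invariant in `t`, hence constant, and equal to that of `exp(-2πi A(0))`
(`exists_fundamental_solution_charpoly_eq`). The latter is read off from the decomposition of `S_k`
(`residue_solution_apply`, `charpoly_of_isInternal`), using `l (k - l + 1) = l (k + 2) - l (l + 1)`.
-/

namespace HitchinGenusTwo

section Analysis

open Set Filter Topology MeasureTheory

/-! ### Linear differential equations with a holomorphic parameter -/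

/-- An integral of a uniformly bounded family of holomorphic functions is holomorphic. Cauchy's
estimate supplies the bound on the derivative needed to differentiate under the integral sign. -/
theorem differentiableOn_intervalIntegral_of_bounded {E : Type*} [NormedAddCommGroup E]
    [NormedSpace ℂ E] {U : Set ℂ} (hU : IsOpen U) {g : ℂ → ℝ → E} {B : ℝ} (a b : ℝ)
    (hc : ∀ t ∈ U, Continuous (g t)) (hd : ∀ s, DifferentiableOn ℂ (fun t => g t s) U)
    (hb : ∀ t ∈ U, ∀ s ∈ uIoc a b, ‖g t s‖ ≤ B) :
    DifferentiableOn ℂ (fun t => ∫ s in a..b, g t s) U := by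
  intro t₀ ht₀
  obtain ⟨δ, hδ, hball⟩ := Metric.isOpen_iff.1 hU t₀ ht₀
  have hsub : ∀ t ∈ Metric.ball t₀ (δ / 2), Metric.closedBall t (δ / 4) ⊆ U := by
    intro t ht w hw
    apply hball
    have h1 := Metric.mem_ball.1 ht
    have h2 := Metric.mem_closedBall.1 hw
    have h3 := dist_triangle w t t₀
    rw [Metric.mem_ball]; linarith
  have hmem : ∀ t ∈ Metric.ball t₀ (δ / 2), t ∈ U := fun t ht =>
    hsub t ht (Metric.mem_closedBall_self (by positivity))
  have hda : ∀ t ∈ U, ∀ s, HasDerivAt (fun t => g t s) (deriv (fun t => g t s) t) t :=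
    fun t ht s => ((hd s).differentiableAt (hU.mem_nhds ht)).hasDerivAt
  refine (intervalIntegral.hasDerivAt_integral_of_dominated_loc_of_deriv_le
    (F' := fun t s => deriv (fun t => g t s) t) (bound := fun _ => B / (δ / 4))
    (Metric.ball_mem_nhds t₀ (half_pos hδ)) ?_ ((hc t₀ ht₀).intervalIntegrable a b) ?_ ?_
    (by simp) ?_).2.differentiableAt.differentiableWithinAt
  · filter_upwards [hU.mem_nhds ht₀] with t ht using (hc t ht).aestronglyMeasurable
  · -- the derivative is a pointwise limit of the continuous difference quotients
    have hseq : Tendsto (fun n : ℕ => ((δ / 2 / ((n : ℝ) + 1) : ℝ) : ℂ)) atTop (𝓝[≠] 0) := by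
      rw [tendsto_nhdsWithin_iff]
      refine ⟨?_, Eventually.of_forall fun n => ?_⟩
      · rw [← Complex.ofReal_zero]
        refine (Complex.continuous_ofReal.tendsto 0).comp ?_
        have := (tendsto_one_div_add_atTop_nhds_zero_nat (𝕜 := ℝ)).const_mul (δ / 2)
        simpa [div_eq_mul_inv] using this
      · have : (0 : ℝ) < δ / 2 / ((n : ℝ) + 1) := by positivity
        exact Complex.ofReal_ne_zero.2 this.ne'
    refine aestronglyMeasurable_of_tendsto_ae atTop
      (f := fun (n : ℕ) s => ((δ / 2 / ((n : ℝ) + 1) : ℝ) : ℂ)⁻¹ •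
        (g (t₀ + ((δ / 2 / ((n : ℝ) + 1) : ℝ) : ℂ)) s - g t₀ s)) (fun n => ?_)
      (Eventually.of_forall fun s => ?_)
    · refine Continuous.aestronglyMeasurable (Continuous.const_smul ?_ _)
      refine (hc _ (hball ?_)).sub (hc t₀ ht₀)
      rw [Metric.mem_ball, dist_eq_norm, add_sub_cancel_left, Complex.norm_real, Real.norm_eq_abs,
        abs_of_pos (by positivity)]
      have : δ / 2 / ((n : ℝ) + 1) ≤ δ / 2 := div_le_self (by positivity) (by simp)
      linarith
    · exact (hasDerivAt_iff_tendsto_slope_zero.1 (hda t₀ ht₀ s)).comp hseq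
  · refine Eventually.of_forall fun s hs t ht => ?_
    refine Complex.norm_deriv_le_of_forall_mem_sphere_norm_le (by positivity) ?_
      fun w hw => hb w (hsub t ht (Metric.sphere_subset_closedBall hw)) s hs
    refine DifferentiableOn.diffContOnCl ?_
    rw [closure_ball _ (by positivity)]
    exact (hd s).mono (hsub t ht)
  · exact Eventually.of_forall fun s _ t ht => hda t (hmem t ht) s

variable {A : Type*} [NormedRing A] [NormedAlgebra ℂ A]

/-- The terms of the Dyson series of the linear equation `y' = K(t, τ) y`, obtained by iterated
integration from the constant `1`. -/
noncomputable def dysonTerm (K : ℂ → ℝ → A) : ℕ → ℂ → ℝ → A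
  | 0, _, _ => 1
  | n + 1, t, τ => ∫ s in (0 : ℝ)..τ, K t s * dysonTerm K n t s

variable {K : ℂ → ℝ → A} {U : Set ℂ} {C : ℝ}

theorem continuous_dysonTerm (hc : ∀ t ∈ U, Continuous (K t)) (n : ℕ) {t : ℂ} (ht : t ∈ U) :
    Continuous (dysonTerm K n t) := by
  induction n with
  | zero => exact continuous_const
  | succ n ih =>
    exact intervalIntegral.continuous_primitive
      (fun a b => ((hc t ht).mul ih).intervalIntegrable a b) 0

theorem hasDerivAt_dysonTerm_succ [CompleteSpace A] (hc : ∀ t ∈ U, Continuous (K t)) (n : ℕ)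
    {t : ℂ} (ht : t ∈ U) (τ : ℝ) :
    HasDerivAt (dysonTerm K (n + 1) t) (K t τ * dysonTerm K n t τ) τ :=
  (((hc t ht).mul (continuous_dysonTerm hc n ht))).integral_hasStrictDerivAt 0 τ |>.hasDerivAt

theorem norm_dysonTerm_le (hC : 0 ≤ C)
    (hb : ∀ t ∈ U, ∀ s, ‖K t s‖ ≤ C) (n : ℕ) {t : ℂ} (ht : t ∈ U) (τ : ℝ) :
    ‖dysonTerm K n t τ‖ ≤ ‖(1 : A)‖ * ((C * |τ|) ^ n / n.factorial) := by
  induction n generalizing τ with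
  | zero => simp [dysonTerm]
  | succ n ih =>
    have h1 : ∀ s, ‖K t s * dysonTerm K n t s‖
        ≤ ‖(1 : A)‖ * C ^ (n + 1) / n.factorial * |s| ^ n := by
      intro s
      calc _ ≤ C * (‖(1 : A)‖ * ((C * |s|) ^ n / n.factorial)) :=
            norm_mul_le_of_le (hb t ht s) (ih s)
        _ = _ := by ring
    have h2 : ‖∫ s in (0 : ℝ)..τ, K t s * dysonTerm K n t s‖
        ≤ |∫ s in (0 : ℝ)..τ, ‖(1 : A)‖ * C ^ (n + 1) / n.factorial * |s| ^ n| :=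
      intervalIntegral.norm_integral_le_abs_of_norm_le (Eventually.of_forall h1)
        (Continuous.intervalIntegrable (by fun_prop) _ _)
    have h3 : |∫ s in (0 : ℝ)..τ, |s| ^ n| = |τ| ^ (n + 1) / (n + 1) := by
      have h4 : ∀ x : ℝ, 0 ≤ x → ∫ s in (0 : ℝ)..x, |s| ^ n = x ^ (n + 1) / (n + 1) := by
        intro x hx
        have : ∫ s in (0 : ℝ)..x, |s| ^ n = ∫ s in (0 : ℝ)..x, s ^ n := by
          refine intervalIntegral.integral_congr fun s hs => ?_
          rw [uIcc_of_le hx] at hs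
          simp only [abs_of_nonneg hs.1]
        rw [this, integral_pow]; simp
      rcases le_total 0 τ with h | h
      · rw [h4 τ h, abs_of_nonneg h, abs_of_nonneg (by positivity)]
      · have h5 : ∫ s in (0 : ℝ)..τ, |s| ^ n = -∫ s in (0 : ℝ)..(-τ), |s| ^ n := by
          have := intervalIntegral.integral_comp_neg (a := 0) (b := -τ) fun s : ℝ => |s| ^ n
          simp only [abs_neg, neg_neg, neg_zero] at this
          rw [this, intervalIntegral.integral_symm]
        rw [h5, abs_neg, h4 _ (by linarith), abs_of_nonpos h, abs_of_nonneg]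
        have : 0 ≤ -τ := by linarith
        positivity
    refine h2.trans (le_of_eq ?_)
    rw [intervalIntegral.integral_const_mul, abs_mul, h3, abs_of_nonneg (by positivity),
      Nat.factorial_succ]
    push_cast
    field_simp
    ring

theorem differentiableOn_dysonTerm (hU : IsOpen U) (hC : 0 ≤ C)
    (hc : ∀ t ∈ U, Continuous (K t)) (hd : ∀ s, DifferentiableOn ℂ (fun t => K t s) U)
    (hb : ∀ t ∈ U, ∀ s, ‖K t s‖ ≤ C) (n : ℕ) (τ : ℝ) :
    DifferentiableOn ℂ (fun t => dysonTerm K n t τ) U := by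
  induction n generalizing τ with
  | zero => exact differentiableOn_const _
  | succ n ih =>
    refine differentiableOn_intervalIntegral_of_bounded hU
      (g := fun t s => K t s * dysonTerm K n t s)
      (B := C * (‖(1 : A)‖ * ((C * |τ|) ^ n / n.factorial))) 0 τ
      (fun t ht => (hc t ht).mul (continuous_dysonTerm hc n ht))
      (fun s => (hd s).mul (ih s)) fun t ht s hs => ?_
    refine norm_mul_le_of_le (hb t ht s) ((norm_dysonTerm_le hC hb n ht s).trans ?_)
    have : |s| ≤ |τ| := by
      rcases le_total 0 τ with h | h
      · rw [uIoc_of_le h] at hs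
        rw [abs_of_pos hs.1, abs_of_nonneg h]; exact hs.2
      · rw [uIoc_of_ge h] at hs
        rw [abs_of_nonpos hs.2, abs_of_nonpos h]; linarith [hs.1]
    gcongr

/-- A linear differential equation whose coefficient is holomorphic in a parameter has a
fundamental solution, defined for all times, that is holomorphic in the parameter: the sum of the
Dyson series. -/
theorem exists_fundamental_solution [CompleteSpace A] (hU : IsOpen U)
    (hc : ∀ t ∈ U, Continuous (K t)) (hd : ∀ s, DifferentiableOn ℂ (fun t => K t s) U)
    (hb : ∀ t ∈ U, ∀ s, ‖K t s‖ ≤ C) :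
    ∃ T : ℂ → ℝ → A, (∀ t ∈ U, T t 0 = 1) ∧
      (∀ t ∈ U, ∀ τ, HasDerivAt (T t) (K t τ * T t τ) τ) ∧
      ∀ τ, DifferentiableOn ℂ (fun t => T t τ) U := by
  rcases U.eq_empty_or_nonempty with rfl | ⟨u, hu⟩
  · exact ⟨fun _ _ => 1, by simp, by simp, by simp⟩
  have hC : 0 ≤ C := (norm_nonneg _).trans (hb u hu 0)
  have hsum : ∀ x : ℝ, Summable fun n : ℕ => ‖(1 : A)‖ * ((C * x) ^ n / n.factorial) := fun x =>
    (Real.summable_pow_div_factorial _).mul_left _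
  have hmono : ∀ R τ : ℝ, |τ| ≤ R → ∀ n : ℕ, ∀ t ∈ U, ‖dysonTerm K n t τ‖
      ≤ ‖(1 : A)‖ * ((C * R) ^ n / n.factorial) := by
    intro R τ h n t ht
    refine (norm_dysonTerm_le hC hb n ht τ).trans ?_
    gcongr
  refine ⟨fun t τ => ∑' n, dysonTerm K n t τ, fun t _ => ?_, fun t ht τ => ?_, fun τ => ?_⟩
  · beta_reduce
    rw [tsum_eq_single 0]
    · rfl
    · intro n hn
      obtain ⟨m, rfl⟩ := Nat.exists_eq_succ_of_ne_zero hn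
      simp [dysonTerm]
  · set R : ℝ := |τ| + 1
    let g' : ℕ → ℝ → A := fun n τ => match n with
      | 0 => 0
      | n + 1 => K t τ * dysonTerm K n t τ
    let u : ℕ → ℝ := fun n => match n with
      | 0 => 0
      | n + 1 => C * (‖(1 : A)‖ * ((C * R) ^ n / n.factorial))
    have hu : Summable u := (summable_nat_add_iff 1).1 ((hsum R).mul_left C)
    have hmem : τ ∈ Metric.ball (0 : ℝ) R := by simp [R]
    have key : HasDerivAt (fun τ => ∑' n, dysonTerm K n t τ) (∑' n, g' n τ) τ := by
      refine hasDerivAt_tsum_of_isPreconnected (t := Metric.ball (0 : ℝ) R) hu Metric.isOpen_ball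
        (convex_ball _ _).isPreconnected (fun n y _ => ?_) (fun n y hy => ?_) hmem ?_ hmem
      · cases n with
        | zero => exact hasDerivAt_const y 1
        | succ n => exact hasDerivAt_dysonTerm_succ hc n ht y
      · cases n with
        | zero => simp [g', u]
        | succ n =>
          exact norm_mul_le_of_le (hb t ht y) (hmono R y (mem_ball_zero_iff.1 hy).le n t ht)
      · exact .of_norm_bounded (hsum |τ|) fun n => norm_dysonTerm_le hC hb n ht τ
    have hg' : ∑' n, g' n τ = K t τ * ∑' n, dysonTerm K n t τ := by
      have hs : Summable fun n => dysonTerm K n t τ :=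
        .of_norm_bounded (hsum |τ|) fun n => norm_dysonTerm_le hC hb n ht τ
      have hs' : Summable fun n => g' n τ :=
        (summable_nat_add_iff 1).1 (hs.mul_left (K t τ))
      rw [hs'.tsum_eq_zero_add, ← hs.tsum_mul_left]
      simp [g']
    rwa [hg'] at key
  · exact Complex.differentiableOn_tsum_of_summable_norm (hsum |τ|)
      (fun n => differentiableOn_dysonTerm hU hC hc hd hb n τ) hU
      fun n t ht => hmono |τ| τ le_rfl n t ht

/-! ### Monodromy around a regular singular point -/

/-- Solutions of a linear differential equation with bounded coefficient are determined by one
value. The coefficient acts through a bilinear map, which covers both vector valued and operator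
valued solutions. -/
theorem linear_ode_unique {A E : Type*} [NormedRing A] [NormedAlgebra ℂ A] [NormedAddCommGroup E]
    [NormedSpace ℂ E] (β : A →L[ℂ] E →L[ℂ] E) {κ : ℝ → A} {C : ℝ} (hb : ∀ τ, ‖κ τ‖ ≤ C)
    {f g : ℝ → E} (hf : ∀ τ, HasDerivAt f (β (κ τ) (f τ)) τ)
    (hg : ∀ τ, HasDerivAt g (β (κ τ) (g τ)) τ) {τ₀ : ℝ} (h : f τ₀ = g τ₀) : f = g := by
  have hlip : ∀ τ, LipschitzOnWith (Real.toNNReal (‖β‖ * C)) (fun y => β (κ τ) y) univ := by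
    intro τ
    refine (LipschitzWith.of_dist_le_mul fun x y => ?_).lipschitzOnWith
    rw [dist_eq_norm, dist_eq_norm, ← map_sub]
    refine (ContinuousLinearMap.le_opNorm _ _).trans ?_
    refine mul_le_mul_of_nonneg_right ?_ (norm_nonneg _)
    refine le_trans ?_ (Real.le_coe_toNNReal _)
    exact (β.le_opNorm _).trans (mul_le_mul_of_nonneg_left (hb τ) (norm_nonneg _))
  exact ODE_solution_unique_univ (v := fun τ y => β (κ τ) y) (s := fun _ => univ) hlip
    (fun τ => ⟨hf τ, mem_univ _⟩) (fun τ => ⟨hg τ, mem_univ _⟩) h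

/-- A holomorphic function on a disc that is invariant under rotations is constant. -/
theorem apply_eq_apply_zero_of_rotation_invariant {f : ℂ → ℂ} {ρ r : ℝ}
    (hf : DifferentiableOn ℂ f (Metric.ball 0 ρ)) (hr : 0 < r) (hrρ : r < ρ)
    (hrot : ∀ θ : ℝ, f (r * Complex.exp (θ * Complex.I)) = f r) : f r = f 0 := by
  have hd : DiffContOnCl ℂ f (Metric.ball 0 r) := by
    refine DifferentiableOn.diffContOnCl ?_
    rw [closure_ball _ hr.ne']
    exact hf.mono (Metric.closedBall_subset_ball hrρ)
  have heq : EqOn f (fun _ => f r) (frontier (Metric.ball 0 r)) := by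
    intro w hw
    rw [frontier_ball _ hr.ne', mem_sphere_zero_iff_norm] at hw
    have := hrot w.arg
    rwa [← hw, Complex.norm_mul_exp_arg_mul_I, hw] at this
  exact (Complex.eqOn_of_eqOn_frontier Metric.isBounded_ball hd diffContOnCl_const heq
    (Metric.mem_ball_self hr)).symm

variable {n : Type*} [Fintype n] [DecidableEq n]

theorem differentiableOn_eval_charpoly {U : Set ℂ} {T : ℂ → ((n → ℂ) →L[ℂ] (n → ℂ))}
    (hT : DifferentiableOn ℂ T U) (x : ℂ) :
    DifferentiableOn ℂ (fun t => (T t : (n → ℂ) →ₗ[ℂ] (n → ℂ)).charpoly.eval x) U := by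
  have hentry : ∀ i j, DifferentiableOn ℂ (fun t => T t (Pi.single j 1) i) U := by
    intro i j
    exact ((ContinuousLinearMap.proj (R := ℂ) (φ := fun _ : n => ℂ) i).differentiable.comp
      (ContinuousLinearMap.apply ℂ (n → ℂ) (Pi.single j 1)).differentiable).comp_differentiableOn hT
  have : ∀ t, (T t : (n → ℂ) →ₗ[ℂ] (n → ℂ)).charpoly.eval x
      = ∑ σ : Equiv.Perm n, (Equiv.Perm.sign σ : ℂ) *
        ∏ i, ((if σ i = i then x else 0) - T t (Pi.single i 1) (σ i)) := by
    intro t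
    rw [← LinearMap.charpoly_toMatrix _ (Pi.basisFun ℂ n), Matrix.eval_charpoly, Matrix.det_apply']
    refine Finset.sum_congr rfl fun σ _ => ?_
    refine congrArg _ (Finset.prod_congr rfl fun i _ => ?_)
    simp [Matrix.scalar_apply, Matrix.diagonal_apply]
  simp only [this]
  refine DifferentiableOn.fun_sum fun σ _ => (differentiableOn_const _).mul ?_
  exact DifferentiableOn.fun_finsetProd fun i _ => (differentiableOn_const _).sub (hentry _ _)

/-- Let `A` be holomorphic on a disc around `0`. The equation `y' = 2πi A(r exp(2πiτ)) y` has a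
fundamental solution `T`, `T(-1)` is the inverse of `T(1)`, and it has the same characteristic
polynomial as its analogue `T₀(-1)` for the constant coefficient `A(0)`.

The fundamental solution `T(t, τ)` is holomorphic in the radius `t`, which is allowed to be any
complex number in the disc. Rotating `t` only moves the base point of the loop, hence conjugates
`T(t, -1)`. So the values of the characteristic polynomial are holomorphic and rotation invariant
functions of `t`, that is, constant. No assumption on differences of eigenvalues of `A(0)` is
needed. -/
theorem exists_fundamental_solution_charpoly_eq {A : ℂ → ((n → ℂ) →L[ℂ] (n → ℂ))} {ε r : ℝ}
    (hA : DifferentiableOn ℂ A (Metric.ball 0 ε)) (hr : 0 < r) (hrε : r < ε) :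
    ∃ T T₀ : ℝ → ((n → ℂ) →L[ℂ] (n → ℂ)), T 0 = 1 ∧ T₀ 0 = 1 ∧
      (∀ τ : ℝ, HasDerivAt T ((2 * Real.pi * Complex.I) •
        A (r * Complex.exp (2 * Real.pi * Complex.I * τ)) * T τ) τ) ∧
      (∀ τ, HasDerivAt T₀ ((2 * Real.pi * Complex.I) • A 0 * T₀ τ) τ) ∧
      T 1 * T (-1) = 1 ∧ T (-1) * T 1 = 1 ∧
      (T (-1) : (n → ℂ) →ₗ[ℂ] (n → ℂ)).charpoly = (T₀ (-1) : (n → ℂ) →ₗ[ℂ] (n → ℂ)).charpoly := by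
  obtain ⟨ρ, hrρ, hρε⟩ := exists_between hrε
  have hcb : Metric.closedBall (0 : ℂ) ρ ⊆ Metric.ball 0 ε := Metric.closedBall_subset_ball hρε
  obtain ⟨C, hC⟩ := (isCompact_closedBall (0 : ℂ) ρ).exists_bound_of_continuousOn
    (hA.continuousOn.mono hcb)
  set e : ℝ → ℂ := fun τ => Complex.exp (2 * Real.pi * Complex.I * τ) with he
  have hnorm : ∀ τ, ‖e τ‖ = 1 := fun τ => by
    simp only [he]
    rw [show 2 * Real.pi * Complex.I * τ = ((2 * Real.pi * τ : ℝ) : ℂ) * Complex.I by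
      push_cast; ring]
    exact Complex.norm_exp_ofReal_mul_I _
  have hadd : ∀ σ τ, e (σ + τ) = e σ * e τ := fun σ τ => by
    simp only [he, ← Complex.exp_add]; congr 1; push_cast; ring
  have he1 : e 1 = 1 := by simp [he, Complex.exp_two_pi_mul_I]
  have hec : Continuous e := by fun_prop
  have hmem : ∀ t ∈ Metric.ball (0 : ℂ) ρ, ∀ τ, t * e τ ∈ Metric.ball (0 : ℂ) ρ := fun t ht τ => by
    simpa [hnorm] using ht
  have hball : Metric.ball (0 : ℂ) ρ ⊆ Metric.ball 0 ε := Metric.ball_subset_ball hρε.le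
  set K : ℂ → ℝ → ((n → ℂ) →L[ℂ] (n → ℂ)) := fun t τ =>
    (2 * Real.pi * Complex.I) • A (t * e τ) with hK
  have hKb : ∀ t ∈ Metric.ball (0 : ℂ) ρ, ∀ τ, ‖K t τ‖ ≤ ‖(2 * Real.pi * Complex.I : ℂ)‖ * C := by
    intro t ht τ
    rw [hK, norm_smul]
    exact mul_le_mul_of_nonneg_left (hC _ (Metric.ball_subset_closedBall (hmem t ht τ)))
      (norm_nonneg _)
  obtain ⟨T, hT0, hT', hTd⟩ := exists_fundamental_solution (K := K) (U := Metric.ball 0 ρ)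
    Metric.isOpen_ball
    (fun t ht => (hA.continuousOn.comp_continuous (f := fun τ => t * e τ) (by fun_prop)
      fun τ => hball (hmem t ht τ)).const_smul (2 * Real.pi * Complex.I))
    (fun τ => (hA.comp (f := fun t => t * e τ) (by fun_prop)
      fun t ht => hball (hmem t ht τ)).const_smul (2 * Real.pi * Complex.I)) hKb
  -- moving the base point: both sides solve the same equation
  have hshift : ∀ t ∈ Metric.ball (0 : ℂ) ρ, ∀ σ τ, T (t * e σ) τ * T t σ = T t (τ + σ) := by
    intro t ht σ τ
    have hf : ∀ τ, HasDerivAt (fun τ => T (t * e σ) τ * T t σ)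
        (K (t * e σ) τ * (T (t * e σ) τ * T t σ)) τ := fun τ => by
      rw [← mul_assoc]; exact (hT' _ (hmem t ht σ) τ).mul_const _
    have hg : ∀ τ, HasDerivAt (fun τ => T t (τ + σ)) (K (t * e σ) τ * T t (τ + σ)) τ := fun τ => by
      have h := (hT' t ht (τ + σ)).comp_add_const τ σ
      have hk : K t (τ + σ) = K (t * e σ) τ := by
        simp only [hK, hadd]; congr 2; ring
      rwa [hk] at h
    exact congrFun (linear_ode_unique (ContinuousLinearMap.compL ℂ (n → ℂ) (n → ℂ) (n → ℂ))
      (hKb _ (hmem t ht σ)) hf hg (τ₀ := 0)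
      (by rw [hT0 _ (hmem t ht σ), one_mul, zero_add])) τ
  have hinv : ∀ t ∈ Metric.ball (0 : ℂ) ρ, ∀ σ, T (t * e σ) (-σ) * T t σ = 1 := fun t ht σ => by
    rw [hshift t ht, neg_add_cancel, hT0 t ht]
  have hinv' : ∀ t ∈ Metric.ball (0 : ℂ) ρ, ∀ σ, T t σ * T (t * e σ) (-σ) = 1 := fun t ht σ => by
    have h := hinv (t * e σ) (hmem t ht σ) (-σ)
    have h0 : e 0 = 1 := by simp [he]
    rwa [mul_assoc, ← hadd, add_neg_cancel, h0, mul_one, neg_neg] at h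
  have hrm : (r : ℂ) ∈ Metric.ball (0 : ℂ) ρ := by simpa [abs_of_pos hr] using hrρ
  have h0m : (0 : ℂ) ∈ Metric.ball (0 : ℂ) ρ := Metric.mem_ball_self (hr.trans hrρ)
  have hem1 : e (-1) = 1 := by
    have := hadd (-1) 1
    rw [he1, mul_one] at this
    rw [← this]; simp [he]
  have hconj : ∀ σ, (T (r * e σ) (-1) : (n → ℂ) →ₗ[ℂ] (n → ℂ)).charpoly
      = (T r (-1) : (n → ℂ) →ₗ[ℂ] (n → ℂ)).charpoly := by
    intro σ
    have h1 : T (r * e σ) (-1) * T r σ = T r σ * T r (-1) := by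
      have h := hshift r hrm (-1) σ
      rw [hem1, mul_one] at h
      rw [hshift r hrm, h, add_comm]
    let E : (n → ℂ) ≃ₗ[ℂ] (n → ℂ) := LinearEquiv.ofLinearMap (T r σ : (n → ℂ) →ₗ[ℂ] (n → ℂ))
      (T (r * e σ) (-σ) : (n → ℂ) →ₗ[ℂ] (n → ℂ))
      (LinearMap.ext fun x => congrArg (fun L : (n → ℂ) →L[ℂ] (n → ℂ) => L x) (hinv' r hrm σ))
      (LinearMap.ext fun x => congrArg (fun L : (n → ℂ) →L[ℂ] (n → ℂ) => L x) (hinv r hrm σ))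
    rw [← LinearEquiv.charpoly_conj E (T r (-1) : (n → ℂ) →ₗ[ℂ] (n → ℂ))]
    congr 1
    refine LinearMap.ext fun x => ?_
    have h2 : T (r * e σ) (-1) = T r σ * T r (-1) * T (r * e σ) (-σ) := by
      rw [← h1, mul_assoc, hinv' r hrm, mul_one]
    rw [h2]
    rfl
  refine ⟨T r, T 0, hT0 r hrm, hT0 0 h0m, hT' r hrm, fun τ => ?_, ?_, ?_, ?_⟩
  · simpa [hK] using hT' 0 h0m τ
  · simpa [he1] using hinv' r hrm 1
  · simpa [he1] using hinv r hrm 1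
  · refine Polynomial.funext fun x => ?_
    refine apply_eq_apply_zero_of_rotation_invariant (f := fun t =>
      (T t (-1) : (n → ℂ) →ₗ[ℂ] (n → ℂ)).charpoly.eval x)
      (differentiableOn_eval_charpoly (hTd (-1)) x) hr hrρ fun θ => ?_
    have hθ : Complex.exp (θ * Complex.I) = e (θ / (2 * Real.pi)) := by
      have : (Real.pi : ℂ) ≠ 0 := Complex.ofReal_ne_zero.2 Real.pi_ne_zero
      simp only [he]; congr 1; push_cast; field_simp
    rw [hθ, hconj]

end Analysis

section Polynomials

open MvPolynomial

local notation "Idx" => Fin 2 → ZMod 2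

/-! ### The symbols of the operators `Ω_ij` -/


theorem envRep_Omega (i j : Fin 6) : envRep (Omega i j) = polyRep (F i j) * polyRep (F i j) := by
  simp [Omega, envRep, map_mul]

theorem polyRep_X (A : SO6) (l : Idx) :
    polyRep A (X l) = ∑ i, C (halfSpin A (Pi.single l 1) i) * X i := by
  refine (diffOp_X _ l).trans ?_
  simp [LinearMap.toMatrix'_apply]

theorem polyRep_mul (A : SO6) (f g : S) :
    polyRep A (f * g) = f * polyRep A g + g * polyRep A f :=
  Derivation.leibniz (diffOp (LinearMap.toMatrix' (halfSpin A))) f g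

theorem polyRep_one (A : SO6) : polyRep A 1 = 0 :=
  Derivation.map_one_eq_zero (diffOp (LinearMap.toMatrix' (halfSpin A)))

theorem symbol_apply (D : Module.End ℂ S) (f : S) :
    symbol D f = ∑ a : Idx, ∑ b : Idx,
      (D (X a * X b) - X a * D (X b) - X b * D (X a) + X a * X b * D 1)
        * pderiv a (pderiv b f) := by
  simp only [symbol, LinearMap.sum_apply, LinearMap.comp_apply, LinearMap.mulLeft_apply]
  rfl

/-- The symbol of the square of a first order operator `L` is `2 ∑ L(X_i) L(X_j) ∂_i ∂_j`. -/
theorem symbol_Omega (i j : Fin 6) (f : S) :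
    symbol (envRep (Omega i j)) f = ∑ a : Idx, ∑ b : Idx,
      2 * (polyRep (F i j) (X a) * polyRep (F i j) (X b)) * pderiv a (pderiv b f) := by
  simp only [symbol_apply, envRep_Omega, Module.End.mul_apply, polyRep_mul, polyRep_one, map_add,
    map_zero, mul_zero]
  refine Finset.sum_congr rfl fun a _ => Finset.sum_congr rfl fun b _ => ?_
  ring

theorem symbol_add (D E : Module.End ℂ S) : symbol (D + E) = symbol D + symbol E := by
  refine LinearMap.ext fun f => ?_
  simp only [symbol_apply, LinearMap.add_apply, ← Finset.sum_add_distrib]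
  refine Finset.sum_congr rfl fun a _ => Finset.sum_congr rfl fun b _ => ?_
  ring

theorem isHomogeneous_polyRep_X (A : SO6) (l : Idx) : (polyRep A (X l)).IsHomogeneous 1 := by
  rw [polyRep_X]
  exact IsHomogeneous.sum _ _ _ fun i _ => isHomogeneous_C_mul_X _ _

/-- Multiplying by a linear form after differentiating preserves the degree, also with an operator
`G` that preserves degrees in between. The statement avoids the truncated subtraction in the degree
`k - 1` of `∂_a f`. -/
theorem mul_pderiv_mem_Sk {k : ℕ} {f p : S} (hf : f ∈ Sk k) (hp : p.IsHomogeneous 1) (a : Idx)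
    (G : S → S) (hG0 : G 0 = 0) (hG : ∀ m, ∀ g ∈ Sk m, G g ∈ Sk m) : p * G (pderiv a f) ∈ Sk k := by
  have h := IsHomogeneous.pderiv (i := a) hf
  cases k with
  | zero =>
    have : pderiv a f = 0 := by
      have h0 : f.totalDegree = 0 := (totalDegree_zero_iff_isHomogeneous _).2 hf
      rw [totalDegree_eq_zero_iff_eq_C.1 h0, pderiv_C]
    rw [this, hG0, mul_zero]; exact zero_mem _
  | succ k =>
    have := hp.mul (hG k _ h)
    rwa [add_comm] at this

theorem pderiv_comm (a b : Idx) (f : S) :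
    (pderiv a (pderiv b f) : S) = pderiv b (pderiv a f) := by
  have : ⁅(pderiv a : Derivation ℂ S S), (pderiv b : Derivation ℂ S S)⁆ = 0 := by
    refine derivation_ext fun l => ?_
    simp [Derivation.commutator_apply, pderiv_X, Pi.single_apply, apply_ite]
  have h := congrArg (fun D : Derivation ℂ S S => D f) this
  simp only [Derivation.commutator_apply, Derivation.zero_apply] at h
  exact sub_eq_zero.1 h

theorem symbol_Omega_mem_Sk (i j : Fin 6) {k : ℕ} {f : S} (hf : f ∈ Sk k) :
    symbol (envRep (Omega i j)) f ∈ Sk k := by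
  rw [symbol_Omega]
  refine sum_mem fun a _ => sum_mem fun b _ => ?_
  have h := mul_pderiv_mem_Sk hf (isHomogeneous_polyRep_X (F i j) b) b
    (fun g => polyRep (F i j) (X a) * pderiv a g) (by simp) fun m g hg =>
      mul_pderiv_mem_Sk hg (isHomogeneous_polyRep_X (F i j) a) a id rfl fun _ _ => id
  have h2 := (Sk k).smul_mem (2 : ℂ) h
  convert h2 using 1
  rw [smul_eq_C_mul]
  change _ = C 2 * (polyRep (F i j) (X b) * (polyRep (F i j) (X a) * pderiv a (pderiv b f)))
  rw [map_ofNat]; ring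

theorem symbol_Omega_comm (i j : Fin 6) :
    symbol (envRep (Omega i j)) = symbol (envRep (Omega j i)) := by
  have h : F j i = -F i j := by
    apply Subtype.ext
    simp only [F, NegMemClass.coe_neg]
    rw [← smul_neg, neg_sub]
  refine LinearMap.ext fun f => ?_
  simp [symbol_Omega, h]

theorem sum_idx {M : Type*} [AddCommMonoid M] (g : Idx → M) :
    ∑ σ, g σ = g ![0, 0] + g ![0, 1] + g ![1, 0] + g ![1, 1] := by
  have : (Finset.univ : Finset Idx) = {![0, 0], ![0, 1], ![1, 0], ![1, 1]} := by decide
  rw [this, Finset.sum_insert (by decide), Finset.sum_insert (by decide),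
    Finset.sum_insert (by decide), Finset.sum_singleton]
  simp only [add_assoc]

theorem halfSpin_F_apply (j k : Fin 6) (h : j ≠ k) (f : Idx → ℂ) :
    halfSpin (F j k) f = proj (cliff j (cliff k (incl f))) := by
  change proj (spinSharp (F j k) (incl f)) = _
  rw [spinSharp_F j k h]; rfl

theorem cliff_zero_apply (f : (Fin 3 → ZMod 2) → ℂ) (σ : Fin 3 → ZMod 2) :
    cliff 0 f σ = f (σ + ![1, 0, 0]) := by
  have h : point 3 {((0 : Fin 6) : ℕ) + 1, 8} = (![1, 0, 0], ![0, 0, 0]) := by decide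
  simp only [cliff, involution, h, schroedinger, LinearMap.coe_mk, AddHom.coe_mk]
  simp [sgn, dotProduct, Fin.sum_univ_three]

theorem cliff_one_apply (f : (Fin 3 → ZMod 2) → ℂ) (σ : Fin 3 → ZMod 2) :
    cliff 1 f σ = Complex.I * sgn (σ 0) * f (σ + ![1, 0, 0]) := by
  have h : point 3 {((1 : Fin 6) : ℕ) + 1, 8} = (![1, 0, 0], ![1, 0, 0]) := by decide
  simp only [cliff, involution, h, schroedinger, LinearMap.coe_mk, AddHom.coe_mk]
  simp [dotProduct, Fin.sum_univ_three]

theorem cliff_two_apply (f : (Fin 3 → ZMod 2) → ℂ) (σ : Fin 3 → ZMod 2) :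
    cliff 2 f σ = sgn (σ 0) * f (σ + ![0, 1, 0]) := by
  have h : point 3 {((2 : Fin 6) : ℕ) + 1, 8} = (![0, 1, 0], ![1, 0, 0]) := by decide
  simp only [cliff, involution, h, schroedinger, LinearMap.coe_mk, AddHom.coe_mk]
  simp [dotProduct, Fin.sum_univ_three]

/-! ### The half spin representation in coordinates, and `R_123` -/

theorem sgn_add_one (a : ZMod 2) : sgn (a + 1) = -sgn a := by
  rw [sgn_add]; simp [sgn, ZMod.val_one]

theorem sgn_mul_self (a : ZMod 2) : sgn a * sgn a = 1 := by
  rw [← sgn_add, CharTwo.add_self_eq_zero]; simp [sgn]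

theorem incl_apply_even (f : Idx → ℂ) {σ : Fin 3 → ZMod 2} (h : σ 0 + σ 1 + σ 2 = 0) :
    incl f σ = f ![σ 0, σ 1] := if_pos h

theorem halfSpin_F01 (f : Idx → ℂ) (σ : Idx) :
    halfSpin (F 0 1) f σ = -Complex.I * sgn (σ 0) * f σ := by
  rw [halfSpin_F_apply 0 1 (by decide)]
  simp only [proj, LinearMap.coe_mk, AddHom.coe_mk, cliff_zero_apply, cliff_one_apply]
  have h : ∀ σ : Idx, ![σ 0, σ 1, σ 0 + σ 1] + ![1, 0, 0] + ![1, 0, 0]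
      = ![σ 0, σ 1, σ 0 + σ 1] ∧ σ 0 + σ 1 + (σ 0 + σ 1) = 0 ∧ ![σ 0, σ 1] = σ := by decide
  rw [(h σ).1, incl_apply_even _ (h σ).2.1]
  have h2 : (![σ 0, σ 1, σ 0 + σ 1] + ![1, 0, 0] : Fin 3 → ZMod 2) 0 = σ 0 + 1 := rfl
  have h3 : ![(![σ 0, σ 1, σ 0 + σ 1] : Fin 3 → ZMod 2) 0,
    (![σ 0, σ 1, σ 0 + σ 1] : Fin 3 → ZMod 2) 1] = σ := (h σ).2.2
  rw [h2, h3, sgn_add_one]; ring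

/-- A product of two Clifford generators preserves the support `σ_1 + σ_2 + σ_3 = 0`; in the first
two coordinates the shift is by `(1, 1)`. -/
theorem incl_shift (f : Idx → ℂ) (σ : Idx) :
    incl f (![σ 0, σ 1, σ 0 + σ 1] + ![1, 0, 0] + ![0, 1, 0]) = f (σ + ![1, 1]) := by
  have h : ∀ σ : Idx, (![σ 0, σ 1, σ 0 + σ 1] + ![1, 0, 0] + ![0, 1, 0] : Fin 3 → ZMod 2) 0
      + (![σ 0, σ 1, σ 0 + σ 1] + ![1, 0, 0] + ![0, 1, 0] : Fin 3 → ZMod 2) 1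
      + (![σ 0, σ 1, σ 0 + σ 1] + ![1, 0, 0] + ![0, 1, 0] : Fin 3 → ZMod 2) 2 = 0 ∧
      ![(![σ 0, σ 1, σ 0 + σ 1] + ![1, 0, 0] + ![0, 1, 0] : Fin 3 → ZMod 2) 0,
      (![σ 0, σ 1, σ 0 + σ 1] + ![1, 0, 0] + ![0, 1, 0] : Fin 3 → ZMod 2) 1] = σ + ![1, 1] := by
    decide
  rw [incl_apply_even _ (h σ).1, (h σ).2]

theorem halfSpin_F02 (f : Idx → ℂ) (σ : Idx) :
    halfSpin (F 0 2) f σ = -sgn (σ 0) * f (σ + ![1, 1]) := by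
  rw [halfSpin_F_apply 0 2 (by decide)]
  simp only [proj, LinearMap.coe_mk, AddHom.coe_mk, cliff_zero_apply, cliff_two_apply, incl_shift]
  have h2 : (![σ 0, σ 1, σ 0 + σ 1] + ![1, 0, 0] : Fin 3 → ZMod 2) 0 = σ 0 + 1 := rfl
  rw [h2, sgn_add_one]

theorem halfSpin_F12 (f : Idx → ℂ) (σ : Idx) :
    halfSpin (F 1 2) f σ = -Complex.I * f (σ + ![1, 1]) := by
  rw [halfSpin_F_apply 1 2 (by decide)]
  simp only [proj, LinearMap.coe_mk, AddHom.coe_mk, cliff_one_apply, cliff_two_apply, incl_shift]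
  have h2 : (![σ 0, σ 1, σ 0 + σ 1] + ![1, 0, 0] : Fin 3 → ZMod 2) 0 = σ 0 + 1 := rfl
  have h3 : (![σ 0, σ 1, σ 0 + σ 1] : Fin 3 → ZMod 2) 0 = σ 0 := rfl
  rw [h2, h3, sgn_add_one]
  linear_combination -Complex.I * f (σ + ![1, 1]) * sgn_mul_self (σ 0)

theorem polyRep_F01_X (l : Idx) : polyRep (F 0 1) (X l) = -C Complex.I * C (sgn (l 0)) * X l := by
  rw [polyRep_X, Finset.sum_eq_single l]
  · simp [halfSpin_F01]
  · intro i _ hi; simp [halfSpin_F01, hi]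
  · simp

theorem polyRep_shift (A : SO6) (c : Idx → ℂ) (l : Idx)
    (h : ∀ f σ, halfSpin A f σ = c σ * f (σ + ![1, 1])) :
    polyRep A (X l) = C (c (l + ![1, 1])) * X (l + ![1, 1]) := by
  have h2 : ∀ i l : Idx, i + ![1, 1] = l ↔ i = l + ![1, 1] := by decide
  rw [polyRep_X, Finset.sum_eq_single (l + ![1, 1])]
  · rw [h, (h2 (l + ![1, 1]) l).2 rfl]; simp
  · intro i _ hi
    rw [h, Pi.single_eq_of_ne (fun h3 => hi ((h2 i l).1 h3))]; simp
  · simp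

theorem polyRep_F02_X (l : Idx) :
    polyRep (F 0 2) (X l) = C (sgn (l 0)) * X (l + ![1, 1]) := by
  rw [polyRep_shift (F 0 2) (fun σ => -sgn (σ 0)) l halfSpin_F02]
  have : (l + ![1, 1] : Idx) 0 = l 0 + 1 := rfl
  rw [this, sgn_add_one, neg_neg]

theorem polyRep_F12_X (l : Idx) :
    polyRep (F 1 2) (X l) = -C Complex.I * X (l + ![1, 1]) := by
  rw [polyRep_shift (F 1 2) (fun _ => -Complex.I) l halfSpin_F12, map_neg]

/-- The second order Euler identity. -/
theorem sum_sum_X_mul_pderiv_pderiv {k : ℕ} {f : S} (hf : f ∈ Sk k) :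
    ∑ a : Idx, ∑ b : Idx, (X a * X b * pderiv a (pderiv b f) : S)
      = ((k : S) * k - k) * f := by
  have h1 : ∑ a : Idx, X a * pderiv a f = (k : S) * f := by
    rw [IsHomogeneous.sum_X_mul_pderiv hf, nsmul_eq_mul]
  have h2 : ∀ b : Idx, pderiv b (∑ a : Idx, X a * pderiv a f)
      = pderiv b f + ∑ a : Idx, X a * pderiv b (pderiv a f) := by
    intro b
    rw [map_sum]
    simp only [Derivation.leibniz, smul_eq_mul, pderiv_X, Finset.sum_add_distrib]
    rw [add_comm]
    congr 1
    rw [Finset.sum_eq_single b]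
    · simp
    · intro a _ ha; simp [ha.symm]
    · simp
  have h3 : ∑ b : Idx, X b * pderiv b (∑ a : Idx, X a * pderiv a f) = (k : S) * ((k : S) * f) := by
    rw [h1]
    have : ∀ b : Idx, pderiv b ((k : S) * f) = k * pderiv b f := fun b => by
      simp [Derivation.leibniz]
    simp only [this, mul_left_comm _ (k : S), ← Finset.mul_sum, h1]
  simp only [h2, mul_add, Finset.sum_add_distrib, Finset.mul_sum] at h3
  rw [h1] at h3
  simp only [mul_assoc]
  linear_combination h3

theorem RQ_apply (f : S) : RQ f = Q * (pderiv ![0, 0] (pderiv ![1, 0] f)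
    - pderiv ![0, 1] (pderiv ![1, 1] f)) := rfl

/-- The two half spin doublets `(X_00, X_11)` and `(X_01, X_10)` of the `so(3)` generated by
`F_12, F_13, F_23` have the determinant `Q`, and `R_123` is, up to scalars, its Casimir element. -/
theorem R123_apply {k : ℕ} {f : S} (hf : f ∈ Sk k) :
    R123 f = (16 : ℂ) • RQ f + (((-4 * k * (k - 1) : ℚ)) : ℂ) • f := by
  have hE := sum_sum_X_mul_pderiv_pderiv hf
  have hI : (C Complex.I * C Complex.I : S) = -1 := by
    rw [← C_mul, Complex.I_mul_I, map_neg, map_one]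
  have s0 : sgn 0 = 1 := by simp [sgn]
  have s1 : sgn 1 = -1 := by simp [sgn, ZMod.val_one]
  have e00 : (![0, 0] + ![1, 1] : Idx) = ![1, 1] := by decide
  have e01 : (![0, 1] + ![1, 1] : Idx) = ![1, 0] := by decide
  have e10 : (![1, 0] + ![1, 1] : Idx) = ![0, 1] := by decide
  have e11 : (![1, 1] + ![1, 1] : Idx) = ![0, 0] := by decide
  have hc : (C ((-4 * k * (k - 1) : ℚ) : ℂ) : S) = -4 * k * (k - 1) := by
    push_cast; simp only [map_mul, map_neg, map_sub, map_one, map_natCast, map_ofNat]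
  simp only [R123, map_add, symbol_add, LinearMap.smul_apply, LinearMap.add_apply, symbol_Omega,
    RQ_apply, smul_eq_C_mul, hc, polyRep_F01_X, polyRep_F02_X, polyRep_F12_X, sum_idx,
    e00, e01, e10, e11, map_ofNat, Q] at hE ⊢
  simp only [Matrix.cons_val_zero, s0, s1, map_one, map_neg, pderiv_comm ![1, 1] ![0, 0],
    pderiv_comm ![1, 1] ![0, 1], pderiv_comm ![1, 1] ![1, 0], pderiv_comm ![1, 0] ![0, 0],
    pderiv_comm ![1, 0] ![0, 1], pderiv_comm ![0, 1] ![0, 0]] at hE ⊢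
  generalize (C Complex.I : S) = ι at *
  generalize (X ![0, 0] : S) = a at *
  generalize (X ![0, 1] : S) = c at *
  generalize (X ![1, 0] : S) = d at *
  generalize (X ![1, 1] : S) = b at *
  generalize (pderiv ![0, 0] (pderiv ![0, 0] f) : S) = d00 at *
  generalize (pderiv ![0, 0] (pderiv ![0, 1] f) : S) = d01 at *
  generalize (pderiv ![0, 0] (pderiv ![1, 0] f) : S) = d02 at *
  generalize (pderiv ![0, 0] (pderiv ![1, 1] f) : S) = d03 at *
  generalize (pderiv ![0, 1] (pderiv ![0, 1] f) : S) = d11 at *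
  generalize (pderiv ![0, 1] (pderiv ![1, 0] f) : S) = d12 at *
  generalize (pderiv ![0, 1] (pderiv ![1, 1] f) : S) = d13 at *
  generalize (pderiv ![1, 0] (pderiv ![1, 0] f) : S) = d22 at *
  generalize (pderiv ![1, 0] (pderiv ![1, 1] f) : S) = d23 at *
  generalize (pderiv ![1, 1] (pderiv ![1, 1] f) : S) = d33 at *
  have hI' : ι ^ 2 = -1 := by rw [sq, hI]
  ring_nf at hE ⊢
  simp only [hI'] at *
  linear_combination -4 * hE

/-! ### Coordinates on `S_k` -/

/-- The exponents of the monomials of degree `k`. -/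
abbrev Expo (k : ℕ) : Type := ↥(Finset.finsuppAntidiag (Finset.univ : Finset Idx) k)

theorem mem_expo {k : ℕ} {m : Idx →₀ ℕ} :
    m ∈ Finset.finsuppAntidiag (Finset.univ : Finset Idx) k ↔ m.degree = k := by
  simp [Finset.mem_finsuppAntidiag, Finsupp.degree_eq_sum]

theorem card_expo (k : ℕ) : Fintype.card (Expo k) = (k + 3).choose 3 := by
  have h : Fintype.card Idx = 4 := by decide
  rw [Fintype.card_coe, Finset.card_finsuppAntidiag_nat_eq_choose, Finset.card_univ, h,
    show 4 + k - 1 = k + 3 by omega, ← Nat.choose_symm_add]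

theorem coeff_eq_zero_of_mem_Sk {k : ℕ} {f : S} (hf : f ∈ Sk k) {m : Idx →₀ ℕ}
    (hm : m ∉ Finset.finsuppAntidiag (Finset.univ : Finset Idx) k) : coeff m f = 0 :=
  IsHomogeneous.coeff_eq_zero hf fun h => hm (mem_expo.2 h)

/-- The coefficients of the monomials of degree `k`, as a linear map on `S_k`. -/
def coordsMap (k : ℕ) : Sk k →ₗ[ℂ] (Expo k → ℂ) where
  toFun f m := coeff (m : Idx →₀ ℕ) (f : S)
  map_add' f g := by ext; simp
  map_smul' c f := by ext; simp

theorem coordsMap_bijective (k : ℕ) : Function.Bijective (coordsMap k) := by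
  refine ⟨fun f g h => ?_, fun c => ?_⟩
  · refine Subtype.ext (MvPolynomial.ext _ _ fun m => ?_)
    by_cases hm : m ∈ Finset.finsuppAntidiag (Finset.univ : Finset Idx) k
    · exact congrFun h ⟨m, hm⟩
    · rw [coeff_eq_zero_of_mem_Sk f.2 hm, coeff_eq_zero_of_mem_Sk g.2 hm]
  · refine ⟨⟨∑ m : Expo k, monomial (m : Idx →₀ ℕ) (c m), sum_mem fun m _ =>
      isHomogeneous_monomial _ (mem_expo.1 m.2)⟩, ?_⟩
    ext m
    simp only [coordsMap, LinearMap.coe_mk, AddHom.coe_mk, coeff_sum, coeff_monomial]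
    rw [Finset.sum_eq_single m]
    · simp
    · intro b _ hb
      rw [if_neg fun h => hb (Subtype.ext h)]
    · simp

/-- The coefficients of the monomials of degree `k` as linear coordinates on `S_k`. -/
noncomputable def coords (k : ℕ) : Sk k ≃ₗ[ℂ] (Expo k → ℂ) :=
  LinearEquiv.ofBijective (coordsMap k) (coordsMap_bijective k)

theorem coords_apply (k : ℕ) (f : Sk k) (m : Expo k) :
    coords k f m = coeff (m : Idx →₀ ℕ) (f : S) :=
  rfl

theorem finrank_Sk (k : ℕ) : Module.finrank ℂ (Sk k) = (k + 3).choose 3 := by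
  rw [(coords k).finrank_eq, Module.finrank_fintype_fun_eq_card, card_expo]

/-! ### Harmonic decomposition -/

theorem Q_mem : Q ∈ Sk 2 :=
  ((isHomogeneous_X ℂ _).mul (isHomogeneous_X ℂ _)).sub
    ((isHomogeneous_X ℂ _).mul (isHomogeneous_X ℂ _))

theorem XQ_apply (f : S) : XQ f = pderiv ![0, 0] (pderiv ![1, 0] f)
    - pderiv ![0, 1] (pderiv ![1, 1] f) := rfl

theorem XQ_mem {k : ℕ} {f : S} (hf : f ∈ Sk (k + 2)) : XQ f ∈ Sk k :=
  IsHomogeneous.sub (IsHomogeneous.pderiv (IsHomogeneous.pderiv hf))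
    (IsHomogeneous.pderiv (IsHomogeneous.pderiv hf))

theorem XQ_eq_zero {k : ℕ} (hk : k < 2) {f : S} (hf : f ∈ Sk k) : XQ f = 0 := by
  have h0 : ∀ (g : S) (a : Idx), g ∈ Sk 0 → pderiv a g = 0 := by
    intro g a hg
    have h0 : g.totalDegree = 0 := (totalDegree_zero_iff_isHomogeneous _).2 hg
    rw [totalDegree_eq_zero_iff_eq_C.1 h0, pderiv_C]
  have h1 : ∀ a : Idx, pderiv a f ∈ Sk 0 := fun a => by
    have := IsHomogeneous.pderiv (i := a) hf
    rwa [show k - 1 = 0 by omega] at this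
  rw [XQ_apply, h0 _ _ (h1 _), h0 _ _ (h1 _), sub_zero]

/-- The commutation relation `[X_Q, Q] = E + 2`, with `E` the Euler operator. -/
theorem XQ_Q_mul {k : ℕ} {f : S} (hf : f ∈ Sk k) :
    XQ (Q * f) = Q * XQ f + ((k : ℂ) + 2) • f := by
  have hE : ∑ a : Idx, X a * pderiv a f = (k : S) * f := by
    rw [IsHomogeneous.sum_X_mul_pderiv hf, nsmul_eq_mul]
  have hne : (![0, 0] : Idx) ≠ ![0, 1] ∧ (![0, 0] : Idx) ≠ ![1, 0] ∧ (![0, 0] : Idx) ≠ ![1, 1] ∧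
    (![0, 1] : Idx) ≠ ![1, 0] ∧ (![0, 1] : Idx) ≠ ![1, 1] ∧ (![1, 0] : Idx) ≠ ![1, 1] := by decide
  obtain ⟨n1, n2, n3, n4, n5, n6⟩ := hne
  rw [sum_idx] at hE
  simp only [XQ_apply, Q, Derivation.leibniz, map_add, map_sub, smul_eq_mul, pderiv_X_self,
    pderiv_X_of_ne n1, pderiv_X_of_ne n2, pderiv_X_of_ne n3, pderiv_X_of_ne n4,
    pderiv_X_of_ne n5, pderiv_X_of_ne n6, pderiv_X_of_ne n1.symm, pderiv_X_of_ne n2.symm,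
    pderiv_X_of_ne n3.symm, pderiv_X_of_ne n4.symm, pderiv_X_of_ne n5.symm, pderiv_X_of_ne n6.symm,
    mul_zero, add_zero, zero_add, sub_zero, zero_sub, map_neg, mul_one, smul_eq_C_mul,
    map_natCast, map_ofNat]
  linear_combination hE

theorem Qpow_mul_mem {n : ℕ} (l : ℕ) {f : S} (hf : f ∈ Sk n) : Q ^ l * f ∈ Sk (n + 2 * l) := by
  have := ((show Q.IsHomogeneous 2 from Q_mem).pow l).mul hf
  rwa [add_comm] at this

theorem RQ_eq (f : S) : RQ f = Q * XQ f := rfl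

theorem RQ_Qpow_mul {n : ℕ} (l : ℕ) {v : S} (hv : v ∈ Vn n) :
    RQ (Q ^ l * v) = ((l : ℂ) * (n + l + 1)) • (Q ^ l * v) := by
  induction l with
  | zero =>
    have : XQ v = 0 := hv.2
    simp [RQ_eq, this]
  | succ l ih =>
    rw [pow_succ', mul_assoc, RQ_eq, XQ_Q_mul (Qpow_mul_mem l hv.1), ← RQ_eq, ih, mul_add,
      mul_smul_comm, mul_smul_comm, ← add_smul]
    congr 1
    push_cast; ring

theorem XQ_Qpow_succ_mul {n : ℕ} (l : ℕ) {v : S} (hv : v ∈ Vn n) :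
    XQ (Q * (Q ^ l * v)) = (((l : ℂ) + 1) * (n + l + 2)) • (Q ^ l * v) := by
  rw [XQ_Q_mul (Qpow_mul_mem l hv.1), ← RQ_eq, RQ_Qpow_mul l hv, ← add_smul]
  congr 1
  push_cast; ring

theorem mem_QV {k l : ℕ} {f : S} : f ∈ QV k l ↔ ∃ v ∈ Vn (k - 2 * l), Q ^ l * v = f := by
  simp [QV]

theorem Vn_le_QV_zero (k : ℕ) : Vn k ≤ QV k 0 := fun f hf =>
  mem_QV.2 ⟨f, by simpa using hf, by simp⟩

/-- `X_Q Q` is invertible on the sum of the `Q^l V_{k-2l}`, since it acts by a nonzero scalar on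
each of them. -/
theorem iSup_QV_le_map (k : ℕ) : (⨆ l : Fin (k / 2 + 1), QV k l)
    ≤ (⨆ l : Fin (k / 2 + 1), QV k l).map (XQ ∘ₗ LinearMap.mulLeft ℂ Q) := by
  refine iSup_le fun l f hf => ?_
  obtain ⟨v, hv, rfl⟩ := mem_QV.1 hf
  set n := k - 2 * (l : ℕ)
  have hne : ((((l : ℕ) : ℂ) + 1) * (n + (l : ℕ) + 2)) ≠ 0 := by
    exact_mod_cast (by positivity : (((l : ℕ) + 1) * (n + l + 2)) ≠ 0)
  refine ⟨((((l : ℕ) : ℂ) + 1) * (n + (l : ℕ) + 2))⁻¹ • (Q ^ (l : ℕ) * v),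
    Submodule.smul_mem _ _ (Submodule.mem_iSup_of_mem l hf), ?_⟩
  rw [LinearMap.map_smul, LinearMap.comp_apply, LinearMap.mulLeft_apply, XQ_Qpow_succ_mul _ hv,
    smul_smul, inv_mul_cancel₀ hne, one_smul]

theorem QV_le_Sk {k l : ℕ} (h : 2 * l ≤ k) : QV k l ≤ Sk k := by
  intro f hf
  obtain ⟨v, hv, rfl⟩ := mem_QV.1 hf
  have := Qpow_mul_mem l hv.1
  rwa [Nat.sub_add_cancel h] at this

theorem iSup_QV (k : ℕ) : ⨆ l : Fin (k / 2 + 1), QV k l = Sk k := by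
  refine le_antisymm (iSup_le fun l => QV_le_Sk (by omega)) ?_
  induction k using Nat.twoStepInduction with
  | zero => exact fun f hf =>
      Submodule.mem_iSup_of_mem 0 (Vn_le_QV_zero _ ⟨hf, XQ_eq_zero (by norm_num) hf⟩)
  | one => exact fun f hf =>
      Submodule.mem_iSup_of_mem 0 (Vn_le_QV_zero _ ⟨hf, XQ_eq_zero (by norm_num) hf⟩)
  | more k ih _ =>
    intro f hf
    obtain ⟨g, hg, hgf⟩ := iSup_QV_le_map k (ih (XQ_mem hf))
    have hQ : (⨆ l : Fin (k / 2 + 1), QV k l)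
        ≤ (⨆ l : Fin ((k + 2) / 2 + 1), QV (k + 2) l).comap (LinearMap.mulLeft ℂ Q) := by
      refine iSup_le fun l p hp => ?_
      obtain ⟨v, hv, rfl⟩ := mem_QV.1 hp
      refine Submodule.mem_iSup_of_mem ⟨(l : ℕ) + 1, by omega⟩ (mem_QV.2 ⟨v, ?_, ?_⟩)
      · rwa [show k + 2 - 2 * ((l : ℕ) + 1) = k - 2 * l by omega]
      · simp [pow_succ', mul_assoc]
    have hg' : g ∈ Sk k := (iSup_le fun l : Fin (k / 2 + 1) => QV_le_Sk (l := l) (by omega)) hg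
    have hV : f - Q * g ∈ Vn (k + 2) := by
      refine ⟨sub_mem hf ?_, ?_⟩
      · simpa using Qpow_mul_mem 1 hg'
      · change XQ (f - Q * g) = 0
        rw [map_sub, sub_eq_zero]; exact hgf.symm
    have h0 : f - Q * g ∈ ⨆ l : Fin ((k + 2) / 2 + 1), QV (k + 2) l :=
      Submodule.mem_iSup_of_mem 0 (Vn_le_QV_zero _ hV)
    have := add_mem h0 (hQ hg)
    simpa using this

/-- `X_Q : S_{k+2} → S_k` is onto. -/
theorem exists_XQ_eq {k : ℕ} {h : S} (hh : h ∈ Sk k) : ∃ f ∈ Sk (k + 2), XQ f = h := by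
  rw [← iSup_QV] at hh
  obtain ⟨g, hg, rfl⟩ := iSup_QV_le_map k hh
  rw [SetLike.mem_coe, iSup_QV] at hg
  exact ⟨Q * g, by simpa using Qpow_mul_mem 1 hg, rfl⟩

theorem QV_le_eigenspace {k l : ℕ} (h : 2 * l ≤ k) :
    QV k l ≤ Module.End.eigenspace RQ ((l : ℂ) * ((k : ℂ) - (l : ℂ) + 1)) := by
  intro f hf
  obtain ⟨v, hv, rfl⟩ := mem_QV.1 hf
  rw [Module.End.mem_eigenspace_iff, RQ_Qpow_mul l hv, Nat.cast_sub h]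
  congr 1
  push_cast; ring

theorem eigenvalue_injective (k : ℕ) : Function.Injective
    fun l : Fin (k / 2 + 1) => ((l : ℕ) : ℂ) * ((k : ℂ) - ((l : ℕ) : ℂ) + 1) := by
  intro l m h
  have h1 : (((l : ℕ) : ℂ) - (m : ℕ)) * ((k : ℂ) + 1 - ((l : ℕ) + (m : ℕ) : ℕ)) = 0 := by
    push_cast; linear_combination h
  rcases mul_eq_zero.1 h1 with h2 | h2
  · exact Fin.ext (Nat.cast_injective (sub_eq_zero.1 h2))
  · have : k + 1 = (l : ℕ) + m := by exact_mod_cast sub_eq_zero.1 h2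
    omega

theorem iSupIndep_eigenspaces (k : ℕ) : iSupIndep fun l : Fin (k / 2 + 1) =>
    Module.End.eigenspace RQ (((l : ℕ) : ℂ) * ((k : ℂ) - ((l : ℕ) : ℂ) + 1)) :=
  (Module.End.eigenspaces_iSupIndep RQ).comp (eigenvalue_injective k)

theorem iSupIndep_QV (k : ℕ) : iSupIndep fun l : Fin (k / 2 + 1) => QV k l :=
  (iSupIndep_eigenspaces k).mono fun _ => QV_le_eigenspace (by omega)

theorem QV_eq {k l : ℕ} (h : 2 * l ≤ k) : QV k l = Sk k ⊓
    Module.End.eigenspace RQ ((l : ℂ) * ((k : ℂ) - (l : ℂ) + 1)) := by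
  refine le_antisymm (le_inf (QV_le_Sk h) (QV_le_eigenspace h)) ?_
  let i : Fin (k / 2 + 1) := ⟨l, by omega⟩
  -- the modular law, applied to `S_k = Q^l V_{k-2l} ⊕ N` with `N` the sum of the other summands
  have hS : Sk k = QV k l ⊔ ⨆ j ≠ i, QV k (j : Fin (k / 2 + 1)) := by
    rw [← iSup_QV k]
    refine le_antisymm (iSup_le fun j => ?_) (sup_le (le_iSup (fun j : Fin (k / 2 + 1) => QV k j) i)
      (iSup₂_le fun j _ => le_iSup (fun j : Fin (k / 2 + 1) => QV k j) j))
    by_cases hj : j = i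
    · rw [hj]; exact le_sup_left
    · exact le_sup_of_le_right (le_iSup₂_of_le j hj le_rfl)
  have hdis : Disjoint (Module.End.eigenspace RQ ((l : ℂ) * ((k : ℂ) - (l : ℂ) + 1)))
      (⨆ j ≠ i, QV k (j : Fin (k / 2 + 1))) :=
    Disjoint.mono_right (iSup₂_mono fun j _ => QV_le_eigenspace (by omega))
      (iSupIndep_eigenspaces k i)
  rw [hS, sup_inf_assoc_of_le _ (QV_le_eigenspace h)]
  exact sup_le le_rfl ((le_of_eq (disjoint_iff.1 hdis.symm)).trans bot_le)

/-- The difference `dim S_{k+2} - dim S_k` is a square. -/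
theorem choose_three_add_two (k : ℕ) : (k + 5).choose 3 = (k + 3) ^ 2 + (k + 3).choose 3 := by
  have h : ∀ m : ℕ, (m + 1).choose 2 + m.choose 2 = m ^ 2 := by
    intro m
    induction m with
    | zero => rfl
    | succ m ih =>
      rw [Nat.choose_succ_succ' (m + 1) 1, Nat.choose_one_right]
      have := Nat.choose_succ_succ' m 1
      rw [Nat.choose_one_right] at this
      nlinarith
  rw [← h, Nat.choose_succ_succ' (k + 4) 2, Nat.choose_succ_succ' (k + 3) 2]
  ring

theorem finrank_Vn (n : ℕ) : Module.finrank ℂ (Vn n) = (n + 1) ^ 2 := by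
  have hlow : ∀ n < 2, Vn n = Sk n := fun n hn =>
    inf_eq_left.2 fun f hf => XQ_eq_zero hn hf
  match n with
  | 0 => rw [hlow 0 (by norm_num), finrank_Sk]; rfl
  | 1 => rw [hlow 1 (by norm_num), finrank_Sk]; rfl
  | k + 2 =>
    let D : Sk (k + 2) →ₗ[ℂ] Sk k := XQ.restrict fun f hf => XQ_mem hf
    have hsurj : LinearMap.range D = ⊤ := LinearMap.range_eq_top.2 fun h => by
      obtain ⟨f, hf, hfh⟩ := exists_XQ_eq h.2
      exact ⟨⟨f, hf⟩, Subtype.ext hfh⟩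
    have hker : Vn (k + 2) = (LinearMap.ker D).map (Sk (k + 2)).subtype := by
      ext f
      simp only [Vn, Submodule.mem_inf, Submodule.mem_map, LinearMap.mem_ker]
      constructor
      · rintro ⟨h1, h2⟩; exact ⟨⟨f, h1⟩, Subtype.ext h2, rfl⟩
      · rintro ⟨g, h1, rfl⟩; exact ⟨g.2, congrArg Subtype.val h1⟩
    have h := LinearMap.finrank_range_add_finrank_ker D
    rw [hsurj, finrank_top, finrank_Sk, finrank_Sk] at h
    rw [hker, Submodule.finrank_map_subtype_eq]
    have := choose_three_add_two k
    rw [show k + 2 + 3 = k + 5 by ring] at h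
    rw [show k + 2 + 1 = k + 3 by ring]
    omega

/-! ### The monodromy of the degenerating loop -/

/-- The coefficient of `σ(Ω_ij) dt / t` in the pull-back of `∑ σ(Ω_ij) dz_i / (z_i - z_j)` under
`degeneration z`. It is holomorphic in `t` near `0`: the factors `t²` cancel when `i` and `j`
are both among the first three indices. -/
noncomputable def degCoeff (z : Fin 6 → ℂ) (i j : Fin 6) (t : ℂ) : ℂ :=
  if (i : ℕ) < 3 then
    if (j : ℕ) < 3 then 2 * z i / (z i - z j) else 2 * (t ^ 2 * z i) / (t ^ 2 * z i - z j)
  else 0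

/-- The operator `A(t)` such that the connection form pulls back to `A(t) dt / t` under
`degeneration z`. -/
noncomputable def degForm (k : ℕ) (z : Fin 6 → ℂ) (t : ℂ) : Module.End ℂ S :=
  (-1 / (16 * ((k : ℂ) + 2))) •
    ∑ i : Fin 6, ∑ j ∈ Finset.univ.erase i, degCoeff z i j t • symbol (envRep (Omega i j))

theorem hasDerivAt_dehnLoop (z : Fin 6 → ℂ) (r τ : ℝ) (i : Fin 6) :
    HasDerivAt (fun τ' => dehnLoop z r τ' i) (if (i : ℕ) < 3 then
      2 * Real.pi * Complex.I * (2 * ((r * Complex.exp (2 * Real.pi * Complex.I * τ)) ^ 2 * z i))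
      else 0) τ := by
  simp only [dehnLoop, degeneration]
  split_ifs with h
  · have h1 : HasDerivAt (fun τ : ℝ => 2 * Real.pi * Complex.I * (τ : ℂ))
        (2 * Real.pi * Complex.I) τ := by
      simpa using (Complex.ofRealCLM.hasDerivAt (x := τ)).const_mul (2 * Real.pi * Complex.I)
    have h2 := (((h1.cexp.const_mul (r : ℂ)).pow 2).mul_const (z i))
    refine h2.congr_deriv ?_
    push_cast; ring
  · exact hasDerivAt_const _ _

theorem connForm_dehnLoop (k : ℕ) (z : Fin 6 → ℂ) {r : ℝ} (hr : 0 < r) {τ : ℝ}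
    (hτ : τ ∈ Set.Icc (0 : ℝ) 1) :
    connForm k (dehnLoop z r τ) (fun i => derivWithin (fun τ' => dehnLoop z r τ' i)
        (Set.Icc 0 1) τ)
      = (2 * Real.pi * Complex.I) •
        degForm k z (r * Complex.exp (2 * Real.pi * Complex.I * τ)) := by
  have hd : ∀ i, derivWithin (fun τ' => dehnLoop z r τ' i) (Set.Icc 0 1) τ = _ := fun i =>
    (hasDerivAt_dehnLoop z r τ i).hasDerivWithinAt.derivWithin
      (uniqueDiffOn_Icc_zero_one τ hτ)
  set t : ℂ := r * Complex.exp (2 * Real.pi * Complex.I * τ) with ht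
  have ht0 : t ≠ 0 := mul_ne_zero (Complex.ofReal_ne_zero.2 hr.ne') (Complex.exp_ne_zero _)
  rw [connForm, degForm, smul_comm (2 * Real.pi * Complex.I) (-1 / (16 * ((k : ℂ) + 2)))]
  refine congrArg _ ?_
  rw [Finset.smul_sum]
  refine Finset.sum_congr rfl fun i _ => ?_
  rw [Finset.smul_sum]
  refine Finset.sum_congr rfl fun j _ => ?_
  rw [smul_smul, hd]
  congr 1
  simp only [dehnLoop, degeneration, degCoeff, ← ht]
  split_ifs with hi hj
  · rw [← mul_sub, ← mul_assoc (2 : ℂ) (t ^ 2), mul_comm (2 : ℂ) (t ^ 2), mul_assoc (t ^ 2),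
      mul_left_comm, mul_div_mul_left _ _ (pow_ne_zero 2 ht0), mul_div_assoc]
  · rw [mul_div_assoc]
  · simp
  · simp

theorem degForm_zero (k : ℕ) {z : Fin 6 → ℂ} (hz : Function.Injective z) :
    degForm k z 0 = (-1 / (16 * ((k : ℂ) + 2))) • R123 := by
  rw [degForm]
  congr 1
  have h1 : ∀ i : Fin 6, ∑ j ∈ Finset.univ.erase i, degCoeff z i j 0 • symbol (envRep (Omega i j))
      = ∑ j, degCoeff z i j 0 • symbol (envRep (Omega i j)) := fun i =>
    Finset.sum_erase _ (by simp [degCoeff])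
  simp only [h1]
  have hne : ∀ i j : Fin 6, i ≠ j → z i - z j ≠ 0 := fun i j h => sub_ne_zero.2 (hz.ne h)
  have h2 : ∀ i j : Fin 6, i ≠ j → 2 * z i / (z i - z j) + 2 * z j / (z j - z i) = 2 := by
    intro i j h
    have h3 := hne i j h
    rw [← neg_sub (z i) (z j), div_neg, ← sub_eq_add_neg, ← sub_div, ← mul_sub,
      mul_div_cancel_right₀ _ h3]
  have hcomm : ∀ i j : Fin 6, i ≠ j → (2 * z i / (z i - z j)) • symbol (envRep (Omega i j))
      + (2 * z j / (z j - z i)) • symbol (envRep (Omega j i))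
      = (2 : ℂ) • symbol (envRep (Omega i j)) := by
    intro i j h
    rw [symbol_Omega_comm j i, ← add_smul, h2 i j h]
  simp only [Fin.sum_univ_six, degCoeff]
  norm_num
  simp only [R123, map_add, symbol_add, smul_add, ← hcomm 0 1 (by decide), ← hcomm 0 2 (by decide),
    ← hcomm 1 2 (by decide)]
  abel

theorem degForm_mem (k : ℕ) (z : Fin 6 → ℂ) (t : ℂ) {f : S} (hf : f ∈ Sk k) :
    degForm k z t f ∈ Sk k := by
  simp only [degForm, LinearMap.smul_apply, LinearMap.sum_apply]
  exact Submodule.smul_mem _ _ (sum_mem fun i _ => sum_mem fun j _ =>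
    Submodule.smul_mem _ _ (symbol_Omega_mem_Sk i j hf))

theorem differentiableOn_degCoeff {z : Fin 6 → ℂ} (hz : ∀ i, z i ≠ 0) {ε : ℝ}
    (hε : ∀ t : ℂ, 0 < ‖t‖ → ‖t‖ < ε → Function.Injective (degeneration z t)) (i j : Fin 6) :
    DifferentiableOn ℂ (degCoeff z i j) (Metric.ball 0 ε) := by
  intro t ht
  unfold degCoeff
  split_ifs with hi hj
  · fun_prop
  · have hne : t ^ 2 * z i - z j ≠ 0 := by
      rcases eq_or_ne t 0 with rfl | h0
      · simpa using hz j
      · have hij : i ≠ j := fun h => hj (h ▸ hi)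
        have := (hε t (norm_pos_iff.2 h0) (mem_ball_zero_iff.1 ht)).ne hij
        simp only [degeneration, if_pos hi, if_neg hj] at this
        exact sub_ne_zero.2 this
    exact DifferentiableWithinAt.div (by fun_prop) (by fun_prop) hne
  · fun_prop

/-- The operator `σ(Ω_ij)` on `S_k`, in the monomial coordinates. -/
noncomputable def symbolCoords (k : ℕ) (i j : Fin 6) : (Expo k → ℂ) →L[ℂ] (Expo k → ℂ) :=
  LinearMap.toContinuousLinearMap ((coords k).conj
    ((symbol (envRep (Omega i j))).restrict fun _ hf => symbol_Omega_mem_Sk i j hf))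

/-- The operator `A(t)` of `degForm` on `S_k`, in the monomial coordinates. -/
noncomputable def degCoords (k : ℕ) (z : Fin 6 → ℂ) (t : ℂ) :
    (Expo k → ℂ) →L[ℂ] (Expo k → ℂ) :=
  (-1 / (16 * ((k : ℂ) + 2))) •
    ∑ i : Fin 6, ∑ j ∈ Finset.univ.erase i, degCoeff z i j t • symbolCoords k i j

theorem degCoords_coords (k : ℕ) (z : Fin 6 → ℂ) (t : ℂ) (f : Sk k) (m : Expo k) :
    degCoords k z t (coords k f) m = coeff (m : Idx →₀ ℕ) (degForm k z t f) := by
  have h : ∀ i j, symbolCoords k i j (coords k f) m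
      = coeff (m : Idx →₀ ℕ) (symbol (envRep (Omega i j)) f) := by
    intro i j
    simp only [symbolCoords, LinearMap.coe_toContinuousLinearMap', LinearEquiv.conj_apply_apply,
      LinearEquiv.symm_apply_apply]
    rfl
  simp [degCoords, degForm, h, LinearMap.sum_apply, coeff_sum]

theorem differentiableOn_degCoords (k : ℕ) {z : Fin 6 → ℂ} (hz : ∀ i, z i ≠ 0) {ε : ℝ}
    (hε : ∀ t : ℂ, 0 < ‖t‖ → ‖t‖ < ε → Function.Injective (degeneration z t)) :
    DifferentiableOn ℂ (degCoords k z) (Metric.ball 0 ε) :=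
  DifferentiableOn.const_smul (DifferentiableOn.fun_sum fun i _ => DifferentiableOn.fun_sum
    fun j _ => (differentiableOn_degCoeff hz hε i j).smul_const _) (-1 / (16 * ((k : ℂ) + 2)))

/-- Flatness along the degenerating loop, in terms of `A(t)`. -/
theorem isFlatSection_iff (k : ℕ) (z : Fin 6 → ℂ) {r : ℝ} (hr : 0 < r) (s : ℝ → S) :
    IsFlatSection k (dehnLoop z r) s ↔ ∀ τ ∈ Set.Icc (0 : ℝ) 1, s τ ∈ Sk k ∧
      ∀ m : Idx →₀ ℕ, HasDerivWithinAt (fun τ' => coeff m (s τ'))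
        (2 * Real.pi * Complex.I *
          coeff m (degForm k z (r * Complex.exp (2 * Real.pi * Complex.I * τ)) (s τ)))
        (Set.Icc 0 1) τ := by
  refine forall₂_congr fun τ hτ => and_congr_right fun _ => forall_congr' fun m => ?_
  rw [connForm_dehnLoop k z hr hτ, LinearMap.smul_apply, coeff_smul, smul_eq_mul]

/-- The monodromy of the degenerating loop is the inverse of the time one value of a fundamental
solution in coordinates. -/
theorem isMonodromy_of_fundamental_solution (k : ℕ) (z : Fin 6 → ℂ) {r : ℝ} (hr : 0 < r)
    (hA : ContinuousOn (degCoords k z) (Metric.sphere 0 r))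
    {T : ℝ → ((Expo k → ℂ) →L[ℂ] (Expo k → ℂ))} (hT0 : T 0 = 1)
    (hT : ∀ τ : ℝ, HasDerivAt T ((2 * Real.pi * Complex.I) •
      degCoords k z (r * Complex.exp (2 * Real.pi * Complex.I * τ)) * T τ) τ)
    (h1 : T 1 * T (-1) = 1) (h2 : T (-1) * T 1 = 1) :
    IsMonodromy k (dehnLoop z r)
      ((coords k).symm.conj (T (-1) : (Expo k → ℂ) →ₗ[ℂ] (Expo k → ℂ))) := by
  set E := Expo k → ℂ
  have hTy : ∀ (y : E) (τ : ℝ), HasDerivAt (fun τ => T τ y) ((2 * Real.pi * Complex.I) •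
      degCoords k z (r * Complex.exp (2 * Real.pi * Complex.I * τ)) (T τ y)) τ := by
    intro y τ
    exact ((ContinuousLinearMap.apply ℂ E y).restrictScalars ℝ).hasFDerivAt.comp_hasDerivAt τ (hT τ)
  have hM : ∀ v w : Sk k, (coords k).symm.conj (T (-1) : E →ₗ[ℂ] E) v = w ↔
      T (-1) (coords k v) = coords k w := by
    intro v w
    rw [LinearEquiv.conj_apply_apply, LinearEquiv.symm_symm, LinearEquiv.symm_apply_eq]
    rfl
  have hL1 : ∀ x, T 1 (T (-1) x) = x := fun x => congrArg (fun L : E →L[ℂ] E => L x) h1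
  have hL2 : ∀ x, T (-1) (T 1 x) = x := fun x => congrArg (fun L : E →L[ℂ] E => L x) h2
  intro v w
  rw [hM]
  constructor
  · intro hvw
    refine ⟨fun τ => (coords k).symm (T τ (coords k w)), ?_, ?_, ?_⟩
    · rw [isFlatSection_iff k z hr]
      refine fun τ _ => ⟨((coords k).symm _).2, fun m => HasDerivAt.hasDerivWithinAt ?_⟩
      by_cases hm : m ∈ Finset.finsuppAntidiag (Finset.univ : Finset Idx) k
      · have h := (hasDerivAt_pi.1 (hTy (coords k w) τ)) ⟨m, hm⟩
        have hc : ∀ τ', coeff m ((coords k).symm (T τ' (coords k w)) : S)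
            = T τ' (coords k w) ⟨m, hm⟩ := fun τ' => by
          rw [← coords_apply k _ ⟨m, hm⟩, LinearEquiv.apply_symm_apply]
        simp only [hc]
        refine h.congr_deriv ?_
        rw [← degCoords_coords k z _ _ ⟨m, hm⟩, LinearEquiv.apply_symm_apply]
        rfl
      · rw [coeff_eq_zero_of_mem_Sk (degForm_mem k z _ ((coords k).symm _).2) hm, mul_zero]
        simp only [coeff_eq_zero_of_mem_Sk ((coords k).symm _).2 hm]
        exact hasDerivAt_const _ _
    · beta_reduce
      rw [← hvw, hL1, LinearEquiv.symm_apply_apply]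
    · simp [hT0]
  · rintro ⟨s, hs, hs1, hs0⟩
    rw [isFlatSection_iff k z hr] at hs
    let y : ℝ → E := fun τ m => coeff (m : Idx →₀ ℕ) (s τ)
    have hy : ∀ τ ∈ Set.Icc (0 : ℝ) 1, HasDerivWithinAt y ((2 * Real.pi * Complex.I) •
        degCoords k z (r * Complex.exp (2 * Real.pi * Complex.I * τ)) (y τ)) (Set.Icc 0 1) τ := by
      intro τ hτ
      have hc : y τ = coords k ⟨s τ, (hs τ hτ).1⟩ := by ext m; rw [coords_apply]
      refine hasDerivWithinAt_pi.2 fun m => ?_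
      have h := (hs τ hτ).2 m
      rw [← degCoords_coords k z _ ⟨s τ, (hs τ hτ).1⟩ m, ← hc] at h
      exact h
    obtain ⟨C, hC⟩ := (isCompact_sphere (0 : ℂ) r).exists_bound_of_continuousOn hA
    have hmem : ∀ τ : ℝ, (r : ℂ) * Complex.exp (2 * Real.pi * Complex.I * τ)
        ∈ Metric.sphere (0 : ℂ) r := by
      intro τ
      rw [show 2 * Real.pi * Complex.I * τ = ((2 * Real.pi * τ : ℝ) : ℂ) * Complex.I by
        push_cast; ring, mem_sphere_zero_iff_norm, norm_mul, Complex.norm_exp_ofReal_mul_I,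
        Complex.norm_real, Real.norm_of_nonneg hr.le, mul_one]
    have hlip : ∀ τ : ℝ, LipschitzWith (‖(2 * Real.pi * Complex.I : ℂ)‖₊ * Real.toNNReal C)
        (fun y : E => (2 * Real.pi * Complex.I) •
          degCoords k z (r * Complex.exp (2 * Real.pi * Complex.I * τ)) y) := by
      intro τ
      refine LipschitzWith.of_dist_le_mul fun x y => ?_
      rw [dist_eq_norm, dist_eq_norm, ← smul_sub, ← map_sub, norm_smul, NNReal.coe_mul, coe_nnnorm]
      refine le_trans (mul_le_mul_of_nonneg_left ?_ (norm_nonneg _))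
        (le_of_eq (mul_assoc _ _ _).symm)
      refine (ContinuousLinearMap.le_opNorm _ _).trans ?_
      exact mul_le_mul_of_nonneg_right ((hC _ (hmem τ)).trans (Real.le_coe_toNNReal C))
        (norm_nonneg _)
    have hIci : ∀ τ ∈ Set.Ico (0 : ℝ) 1, Set.Icc (0 : ℝ) 1 ∈ nhdsWithin τ (Set.Ici τ) := fun τ hτ =>
      Icc_mem_nhdsGE_of_mem hτ
    have huniq := ODE_solution_unique (a := 0) (b := 1) (f := y) (g := fun τ => T τ (y 0)) hlip
      (fun τ hτ => (hy τ hτ).continuousWithinAt)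
      (fun τ hτ => (hy τ (Set.Ico_subset_Icc_self hτ)).mono_of_mem_nhdsWithin (hIci τ hτ))
      (fun τ _ => (hTy (y 0) τ).continuousAt.continuousWithinAt)
      (fun τ _ => (hTy (y 0) τ).hasDerivWithinAt) (by simp [hT0])
    have hy1 : y 1 = T 1 (y 0) := huniq (Set.right_mem_Icc.2 zero_le_one)
    have e1 : y 1 = coords k v := by
      ext m; rw [coords_apply, ← hs1]
    have e0 : y 0 = coords k w := by
      ext m; rw [coords_apply, ← hs0]
    rw [← e1, ← e0, hy1, hL2]

/-- The characteristic polynomial of an endomorphism that acts by scalars on the summands of a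
direct sum decomposition. -/
theorem charpoly_of_isInternal {V ι : Type*} [AddCommGroup V] [Module ℂ V]
    [FiniteDimensional ℂ V] [Fintype ι] [DecidableEq ι] {N : ι → Submodule ℂ V}
    (hN : DirectSum.IsInternal N) (f : Module.End ℂ V) (c : ι → ℂ)
    (hf : ∀ i, ∀ x ∈ N i, f x = c i • x) :
    f.charpoly = ∏ i, (Polynomial.X - Polynomial.C (c i)) ^ Module.finrank ℂ (N i) := by
  let b := hN.collectedBasis fun i => Module.finBasis ℂ (N i)
  have hb : LinearMap.toMatrix b b f = Matrix.diagonal fun x => c x.1 := by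
    ext x y
    rw [LinearMap.toMatrix_apply, hf y.1 (b y) (hN.collectedBasis_mem _ _), map_smul,
      Finsupp.smul_apply, Module.Basis.repr_self, Finsupp.single_apply, Matrix.diagonal_apply]
    rcases eq_or_ne x y with rfl | h
    · simp
    · rw [if_neg h.symm, if_neg h, smul_zero]
  rw [← LinearMap.charpoly_toMatrix f b, hb, Matrix.charpoly_diagonal, Fintype.prod_sigma]
  simp

/-- The summand `Q^l V_{k-2l}` as a subspace of `S_k`. -/
noncomputable def QVSub (k : ℕ) (l : Fin (k / 2 + 1)) : Submodule ℂ (Sk k) :=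
  (QV k l).comap (Sk k).subtype

theorem map_QVSub (k : ℕ) (l : Fin (k / 2 + 1)) : (QVSub k l).map (Sk k).subtype = QV k l := by
  rw [QVSub, Submodule.map_comap_subtype]
  exact inf_eq_right.2 (QV_le_Sk (by omega))

theorem isInternal_QVSub (k : ℕ) : DirectSum.IsInternal (QVSub k) := by
  refine DirectSum.isInternal_submodule_of_iSupIndep_of_iSup_eq_top ?_ ?_
  · have hRQ : ∀ f ∈ Sk k, RQ f ∈ Sk k := by
      intro f hf
      by_cases hk : k < 2
      · rw [RQ_eq, XQ_eq_zero hk hf, mul_zero]; exact zero_mem _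
      · obtain ⟨m, rfl⟩ := Nat.exists_eq_add_of_le' (not_lt.1 hk)
        simpa [RQ_eq] using Qpow_mul_mem 1 (XQ_mem hf)
    refine ((Module.End.eigenspaces_iSupIndep (RQ.restrict hRQ)).comp
      (eigenvalue_injective k)).mono fun l f hf => ?_
    have := QV_le_eigenspace (show 2 * (l : ℕ) ≤ k by omega) hf
    rw [Module.End.mem_eigenspace_iff] at this
    exact Module.End.mem_eigenspace_iff.2 (Subtype.ext this)
  · refine Submodule.map_injective_of_injective (Sk k).subtype_injective ?_
    rw [Submodule.map_iSup, Submodule.map_top, Submodule.range_subtype]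
    exact (iSup_congr (map_QVSub k)).trans (iSup_QV k)

theorem Q_ne_zero : Q ≠ 0 := by
  intro h
  have h1 := XQ_Q_mul (k := 0) (isHomogeneous_one _ _ : (1 : S) ∈ Sk 0)
  rw [h, zero_mul, map_zero, zero_mul, zero_add, Nat.cast_zero, zero_add] at h1
  exact smul_ne_zero two_ne_zero one_ne_zero h1.symm

theorem finrank_QVSub (k : ℕ) (l : Fin (k / 2 + 1)) :
    Module.finrank ℂ (QVSub k l) = (k - 2 * l + 1) ^ 2 := by
  rw [← finrank_Vn, ← Submodule.finrank_map_subtype_eq (Sk k) (QVSub k l), map_QVSub]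
  exact (Submodule.equivMapOfInjective _
    (mul_right_injective₀ (pow_ne_zero (l : ℕ) Q_ne_zero)) _).finrank_eq.symm

/-- The eigenvalues of the residue `A(0)`. -/
theorem degCoords_zero_coords (k : ℕ) {z : Fin 6 → ℂ} (hz : Function.Injective z) {l : ℕ}
    (hl : 2 * l ≤ k) (f : Sk k) (hf : (f : S) ∈ QV k l) :
    degCoords k z 0 (coords k f) = (-((l : ℂ) * (k - l + 1) / (k + 2))
      + (k : ℂ) * (k - 1) / (4 * (k + 2))) • coords k f := by
  ext m
  have hk : (k : ℂ) + 2 ≠ 0 := by exact_mod_cast (Nat.succ_ne_zero (k + 1))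
  rw [degCoords_coords, degForm_zero k hz, LinearMap.smul_apply, R123_apply f.2,
    Module.End.mem_eigenspace_iff.1 (QV_le_eigenspace hl hf), Pi.smul_apply, coords_apply,
    smul_smul, ← add_smul, smul_smul, coeff_smul]
  congr 1
  push_cast
  field_simp
  ring

/-- The constant coefficient equation attached to the residue acts on `Q^l V_{k-2l}` by the
exponential of the eigenvalue. -/
theorem residue_solution_apply (k : ℕ) {z : Fin 6 → ℂ} (hz : Function.Injective z) {l : ℕ}
    (hl : 2 * l ≤ k) {T₀ : ℝ → ((Expo k → ℂ) →L[ℂ] (Expo k → ℂ))} (hT0 : T₀ 0 = 1)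
    (hT : ∀ τ, HasDerivAt T₀ ((2 * Real.pi * Complex.I) • degCoords k z 0 * T₀ τ) τ)
    (f : Sk k) (hf : (f : S) ∈ QV k l) :
    T₀ (-1) (coords k f) = (Complex.exp (2 * Real.pi * Complex.I * (-(k * (k - 1)) / (4 * (k + 2))))
      * Complex.exp (-2 * (Real.pi : ℂ) * Complex.I * (((l : ℂ) * ((l : ℂ) + 1)) / ((k : ℂ) + 2))))
      • coords k f := by
  set E := Expo k → ℂ
  have hk : (k : ℂ) + 2 ≠ 0 := by exact_mod_cast (Nat.succ_ne_zero (k + 1))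
  set μ : ℂ := -((l : ℂ) * (k - l + 1) / (k + 2)) + (k : ℂ) * (k - 1) / (4 * (k + 2)) with hμ
  have h1 : ∀ τ : ℝ, HasDerivAt (fun τ => T₀ τ (coords k f))
      (((2 * Real.pi * Complex.I) • degCoords k z 0) (T₀ τ (coords k f))) τ := fun τ =>
    ((ContinuousLinearMap.apply ℂ E (coords k f)).restrictScalars ℝ).hasFDerivAt.comp_hasDerivAt τ
      (hT τ)
  have h2 : ∀ τ : ℝ, HasDerivAt
      (fun τ : ℝ => Complex.exp (2 * Real.pi * Complex.I * μ * τ) • coords k f)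
      (((2 * Real.pi * Complex.I) • degCoords k z 0)
        (Complex.exp (2 * Real.pi * Complex.I * μ * τ) • coords k f)) τ := by
    intro τ
    have h3 : HasDerivAt (fun τ : ℝ => 2 * Real.pi * Complex.I * μ * (τ : ℂ))
        (2 * Real.pi * Complex.I * μ) τ := by
      simpa using (Complex.ofRealCLM.hasDerivAt (x := τ)).const_mul (2 * Real.pi * Complex.I * μ)
    refine (h3.cexp.smul_const (coords k f)).congr_deriv ?_
    rw [map_smul, smul_apply, degCoords_zero_coords k hz hl f hf, ← hμ,
      smul_smul, smul_smul]
    congr 1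
    ring
  have h3 := congrFun (linear_ode_unique (ContinuousLinearMap.id ℂ (E →L[ℂ] E))
    (κ := fun _ => (2 * Real.pi * Complex.I) • degCoords k z 0) (fun _ => le_rfl) h1 h2
    (τ₀ := 0) (by simp [hT0])) (-1)
  beta_reduce at h3
  rw [h3, ← Complex.exp_add]
  congr 1
  -- `l (k - l + 1) = l (k + 2) - l (l + 1)`, and the first term contributes a period
  refine Complex.exp_eq_exp_iff_exists_int.2 ⟨l, ?_⟩
  rw [hμ]
  push_cast
  field_simp
  ring

theorem exists_monodromy_charpoly (k : ℕ) {z : Fin 6 → ℂ} (hz : Function.Injective z)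
    (hz0 : ∀ i, z i ≠ 0) {ε r : ℝ} (hr : 0 < r) (hrε : r < ε)
    (hε : ∀ t : ℂ, 0 < ‖t‖ → ‖t‖ < ε → Function.Injective (degeneration z t)) :
    ∃ M : Module.End ℂ (Sk k), IsMonodromy k (dehnLoop z r) M ∧
      M.charpoly = ∏ l ∈ Finset.range (k / 2 + 1), (Polynomial.X - Polynomial.C
        (Complex.exp (2 * Real.pi * Complex.I * (-(k * (k - 1)) / (4 * (k + 2)))) *
          Complex.exp (-2 * (Real.pi : ℂ) * Complex.I *
            (((l : ℂ) * ((l : ℂ) + 1)) / ((k : ℂ) + 2))))) ^ ((k - 2 * l + 1) ^ 2) := by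
  have hA := differentiableOn_degCoords k hz0 hε
  obtain ⟨T, T₀, hT0, hT₀0, hT, hT₀, h1, h2, hchar⟩ :=
    exists_fundamental_solution_charpoly_eq hA hr hrε
  refine ⟨_, isMonodromy_of_fundamental_solution k z hr (hA.continuousOn.mono
    (Metric.sphere_subset_closedBall.trans (Metric.closedBall_subset_ball hrε))) hT0 hT h1 h2, ?_⟩
  rw [LinearEquiv.charpoly_conj, hchar, ← LinearEquiv.charpoly_conj (coords k).symm,
    charpoly_of_isInternal (isInternal_QVSub k) _ _ fun l f hf => ?_, Finset.prod_range]
  · exact Finset.prod_congr rfl fun l _ => by rw [finrank_QVSub]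
  · rw [LinearEquiv.conj_apply_apply, LinearEquiv.symm_symm, LinearEquiv.symm_apply_eq, map_smul]
    exact residue_solution_apply k hz (by omega) hT₀0 hT₀ f hf

end Polynomials

end HitchinGenusTwo

theorem mainTheorem10 :
    -- `R_123` equals `16 Q X_Q` up to a rational scalar on each `S_k`
    (∃ lam : ℕ → ℚ, ∀ k : ℕ, ∀ f ∈ HitchinGenusTwo.Sk k,
      HitchinGenusTwo.R123 f = (16 : ℂ) • HitchinGenusTwo.RQ f + (lam k : ℂ) • f) ∧
    -- `S_k` is the direct sum of the `Q^l V_{k-2l}`, `0 ≤ l ≤ k/2`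
    (∀ k : ℕ,
      iSupIndep (fun l : Fin (k / 2 + 1) => HitchinGenusTwo.QV k l) ∧
      ⨆ l : Fin (k / 2 + 1), HitchinGenusTwo.QV k l = HitchinGenusTwo.Sk k) ∧
    -- the summands are the eigenspaces of `Q X_Q` on `S_k`, and the dimension of `V_{k-2l}`
    (∀ k l : ℕ, 2 * l ≤ k →
      HitchinGenusTwo.QV k l = HitchinGenusTwo.Sk k ⊓
        Module.End.eigenspace HitchinGenusTwo.RQ ((l : ℂ) * ((k : ℂ) - (l : ℂ) + 1)) ∧
      Module.finrank ℂ (HitchinGenusTwo.Vn (k - 2 * l)) = (k - 2 * l + 1) ^ 2) ∧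
    -- the eigenvalues, with multiplicities, of the monodromy of a separating Dehn twist
    (∀ k : ℕ, ∃ c : ℂ, c ≠ 0 ∧
      ∀ z : Fin 6 → ℂ, Function.Injective z → (∀ i, z i ≠ 0) →
      ∀ ε r : ℝ, 0 < r → r < ε →
        (∀ t : ℂ, 0 < ‖t‖ → ‖t‖ < ε → Function.Injective (HitchinGenusTwo.degeneration z t)) →
        ∃ M : Module.End ℂ (HitchinGenusTwo.Sk k),
          HitchinGenusTwo.IsMonodromy k (HitchinGenusTwo.dehnLoop z r) M ∧
          M.charpoly = ∏ l ∈ Finset.range (k / 2 + 1),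
            (Polynomial.X - Polynomial.C (c * Complex.exp (-2 * (Real.pi : ℂ) * Complex.I *
              (((l : ℂ) * ((l : ℂ) + 1)) / ((k : ℂ) + 2))))) ^ ((k - 2 * l + 1) ^ 2)) := by
  refine ⟨⟨fun k => -4 * k * (k - 1), fun k f hf => HitchinGenusTwo.R123_apply hf⟩,
    fun k => ⟨HitchinGenusTwo.iSupIndep_QV k, HitchinGenusTwo.iSup_QV k⟩,
    fun k l h => ⟨HitchinGenusTwo.QV_eq h, HitchinGenusTwo.finrank_Vn _⟩,
    fun k => ⟨_, Complex.exp_ne_zero _, fun z hz hz0 ε r hr hrε hε =>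
      HitchinGenusTwo.exists_monodromy_charpoly k hz hz0 hr hrε hε⟩⟩
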